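/- Let $q>0$ and $\lambda>0$ be fixed. For an integer $n\ge 1$ with $n\ge\lambda$, let $K_n$ be the complete graph on $n$ vertices with edge set $E_n$, and let $\phi_{n,\lambda,q}$ be the random cluster measure on $\{0,1\}^{E_n}$ with edge weight $p=\lambda/n$ and cluster weight $q$, i.e. the probability measure $$\phi_{n,\lambda,q}[\omega]=\frac{1}{Z_{n,\lambda,q}}\Bigl\{\prod_{e\in E_n}p^{\omega_e}(1-p)^{1-\omega_e}\Bigr\}q^{k(\omega)},$$ where $k(\omega)$ is the number of connected components of the spanning subgraph $K_n(\omega)$ of $K_n$ formed by the open edges $\{e:\omega_e=1\}$ (isolated vertices included), and $Z_{n,\lambda,q}$ is the normalising constant. For real $r$, let $\mathcal N_r$ be the number of connected components of $K_n(\omega)$ with more than $r$ vertices, and let $\mathcal V_r$ be the set of vertices lying in such components. **Lemma.** For every $\varepsilon>0$ there exists $c=c(q,\lambda,\varepsilon)>0$ such that for every integer $n\ge\lambda$ and every $\theta>\varepsilon$, $$\phi_{n,\lambda,q}\bigl[|\mathcal V_{\varepsilon n}|=\lfloor\theta n\rfloor,\ \mathcal N_{\varepsilon n}=1\bigr]\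 \ge\ (1-e^{-cn})\,\phi_{n,\lambda,q}\bigl[|\mathcal V_{\varepsilon n}|=\lfloor\theta n\rfloor\bigr].$$ In particular, for every integer $n\ge\lambda$, with probability at least $1-e^{-cn}$ all vertices in components of size larger than $\varepsilon n$ lie in a single component: $\phi_{n,\lambda,q}[\mathcal N_{\varepsilon n}\le 1]\ge 1-e^{-cn}$. -/

import Mathlib

namespace RandomCluster

/-- A configuration `ω ∈ {0,1}^E` on the edge set `E` of `G`; the edge `e` is open if
`ω e = true` and closed otherwise. -/
abbrev Config {V : Type*} (G : SimpleGraph V) : Type _ := G.edgeSet → Bool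

/-- The spanning subgraph `G(ω) = (V, E(ω))` whose edges are the open edges of `ω`. -/
def openGraph {V : Type*} {G : SimpleGraph V} (ω : Config G) : SimpleGraph V :=
  SimpleGraph.fromEdgeSet {e | ∃ h : e ∈ G.edgeSet, ω ⟨e, h⟩ = true}

/-- The number `k(ω)` of connected components of `G(ω)` (isolated vertices included). -/
noncomputable def numComponents {V : Type*} {G : SimpleGraph V} (ω : Config G) : ℕ :=
  Nat.card (openGraph ω).ConnectedComponent

/-- The unnormalised weight `(∏ e, p ^ ω_e * (1 - p) ^ (1 - ω_e)) * q ^ k(ω)`. -/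
noncomputable def weight {V : Type*} {G : SimpleGraph V} [Fintype G.edgeSet] (p q : ℝ)
    (ω : Config G) : ℝ :=
  (∏ e : G.edgeSet, if ω e = true then p else 1 - p) * q ^ numComponents ω

open Classical in
/-- The measure of the event `A` before normalisation, `Z_{G,p,q}[A]`. -/
noncomputable def unnormalised {V : Type*} [Fintype V] (G : SimpleGraph V) (p q : ℝ)
    (A : Set (Config G)) : ℝ :=
  ∑ ω : Config G, if ω ∈ A then weight p q ω else 0

/-- The partition function `Z_{G,p,q}`. -/
noncomputable def partitionFunction {V : Type*} [Fintype V] (G : SimpleGraph V) (p q : ℝ) : ℝ :=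
  unnormalised G p q Set.univ

/-- The random cluster probability `φ_{G,p,q}[A]` of the event `A`
(for `0 ≤ p ≤ 1` and `q > 0`). -/
noncomputable def prob {V : Type*} [Fintype V] (G : SimpleGraph V) (p q : ℝ)
    (A : Set (Config G)) : ℝ :=
  unnormalised G p q A / partitionFunction G p q

/-- The complete graph `K_n` on the vertex set `Fin n`. -/
abbrev K (n : ℕ) : SimpleGraph (Fin n) := ⊤

/-- `φ_{n,λ,q}[A]`: the random cluster probability on `K_n` with `p = λ / n`. -/
noncomputable def phi (n : ℕ) (lam q : ℝ) (A : Set (Config (K n))) : ℝ :=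
  prob (K n) (lam / n) q A

/-- `𝒱_r`: the set of vertices lying in components of `G(ω)` with more than `r` vertices. -/
def largeVertices {V : Type*} {G : SimpleGraph V} (r : ℝ) (ω : Config G) : Set V :=
  {v | r < (((openGraph ω).connectedComponentMk v).supp.ncard : ℝ)}

/-- `𝒩_r`: the number of components of `G(ω)` with more than `r` vertices. -/
noncomputable def numLarge {V : Type*} {G : SimpleGraph V} (r : ℝ) (ω : Config G) : ℕ :=
  {C : (openGraph ω).ConnectedComponent | r < (C.supp.ncard : ℝ)}.ncard

end RandomCluster

/-!
Write `x = 1 - p` with `p = λ / n`, let `C_m` be the probability that the random graph with edge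
probability `p` on `m` given vertices is connected, and call a component large if it has more than
`ε n` vertices.

*Connection probabilities.* Exploring the roots one at a time gives a recursion for the probability
that `s` vertices are all attached to a set of `r` roots, and induction along it shows
`r / (r + s) * (1 - x ^ (r + s)) ^ s ≤ attachProb ≤ (1 - x ^ (r + s)) ^ s`
(`le_attachProb`, `attachProb_le`). With one root, `C_m` is `(1 - x ^ m) ^ (m - 1)` up to a factor
`m`.

*Two pieces against one.* Let `m = a + b` with `a, b > ε n`. Up to polynomial factors, the sum of
`C_a * C_b * x ^ (a * b)` over the splittings of `m` vertices into parts of sizes `a` and `b`, divided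
by `C_m`, is therefore at most `binom(m, a) * s ^ a * (1 - s) ^ b` with
`s = (1 - x ^ a) / (1 - x ^ m)`. This is the probability that a binomial variable with parameters `m`
and `s` equals `a`. As `t ↦ 1 - x ^ t` is strictly concave, `s` exceeds `a / m` by a constant
(`gap_le`), and a Chernoff bound makes the probability exponentially small in `n`
(`exists_pair_bound`, `exists_split_bound`).

*Many pieces.* Fix the set `U` of vertices in large components. The weight of this event is the
expectation of a product over the components (`prod_splitWeight`), so the component of a given vertex
of `U` can be split off (`clusterSum_eq_sum`). There are fewer than `1 / ε` large components, each
contributing a factor `q`, so splitting them off successively costs a bounded factor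
(`clusterSum_le_geom_mul`), whereas the first splitting gains an exponentially small one. Hence `U` is
a single component up to an exponentially small proportion (`exists_mergedWeight_bound`). Summing over
`U` gives the theorem. The argument treats all values of `q > 0` alike.
-/

namespace RandomCluster

/-! ### Independent Bernoulli coordinates -/

section
open scoped Classical

/-- The expectation of `f` when the coordinates are independent, each `true` with
probability `p`. -/
noncomputable def expect {E : Type*} [Fintype E] (p : ℝ) (f : (E → Bool) → ℝ) : ℝ :=
  ∑ ω : E → Bool, (∏ e, if ω e = true then p else 1 - p) * f ω

theorem expect_prod {E : Type*} [Fintype E] (p : ℝ) (h : E → Bool → ℝ) :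
    expect p (fun ω => ∏ e, h e (ω e)) = ∏ e, (p * h e true + (1 - p) * h e false) := by
  unfold expect
  simp_rw [← Finset.prod_mul_distrib]
  have := (Finset.prod_univ_sum (fun _ : E => (Finset.univ : Finset Bool))
    (fun e b => (if b = true then p else 1 - p) * h e b)).symm
  rw [Fintype.piFinset_univ] at this
  simpa using this

theorem expect_one {E : Type*} [Fintype E] (p : ℝ) : expect (E := E) p (fun _ => 1) = 1 := by
  simpa using expect_prod (E := E) p (fun _ _ => 1)

theorem expect_cylinder {E : Type*} [Fintype E] (p : ℝ) {F₁ F₂ : Finset E}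
    (hF : Disjoint F₁ F₂) :
    expect p (fun ω => if (∀ e ∈ F₁, ω e = true) ∧ (∀ e ∈ F₂, ω e = false) then 1 else 0) =
      p ^ F₁.card * (1 - p) ^ F₂.card := by
  have h1 : (fun ω : E → Bool =>
      if (∀ e ∈ F₁, ω e = true) ∧ (∀ e ∈ F₂, ω e = false) then (1 : ℝ) else 0) =
      fun ω => ∏ e, if (e ∈ F₁ → ω e = true) ∧ (e ∈ F₂ → ω e = false) then (1 : ℝ) else 0 := by
    funext ω
    rw [Finset.prod_ite_zero]
    simp only [Finset.prod_const_one, Finset.mem_univ, true_imp_iff, forall_and]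
  rw [h1, expect_prod p (fun e b => if (e ∈ F₁ → b = true) ∧ (e ∈ F₂ → b = false) then 1 else 0)]
  have h2 : ∀ e, (p * (if (e ∈ F₁ → true = true) ∧ (e ∈ F₂ → true = false) then (1 : ℝ) else 0) +
      (1 - p) * (if (e ∈ F₁ → false = true) ∧ (e ∈ F₂ → false = false) then (1 : ℝ) else 0)) =
      (if e ∈ F₁ then p else 1) * (if e ∈ F₂ then 1 - p else 1) := by
    intro e
    have : e ∈ F₁ → e ∉ F₂ := fun h => Finset.disjoint_left.1 hF h
    by_cases h1 : e ∈ F₁ <;> by_cases h2 : e ∈ F₂ <;> simp_all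
  rw [Finset.prod_congr rfl (fun e _ => h2 e), Finset.prod_mul_distrib]
  simp [Finset.prod_ite_mem]

theorem expect_mono {E : Type*} [Fintype E] {p : ℝ} (h0 : 0 ≤ p) (h1 : p ≤ 1)
    {f g : (E → Bool) → ℝ} (h : ∀ ω, f ω ≤ g ω) : expect p f ≤ expect p g := by
  refine Finset.sum_le_sum fun ω _ => mul_le_mul_of_nonneg_left (h ω) ?_
  refine Finset.prod_nonneg fun e _ => ?_
  split_ifs <;> linarith

theorem expect_nonneg {E : Type*} [Fintype E] {p : ℝ} (h0 : 0 ≤ p) (h1 : p ≤ 1)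
    {f : (E → Bool) → ℝ} (h : ∀ ω, 0 ≤ f ω) : 0 ≤ expect p f := by
  have := expect_mono h0 h1 h
  simpa [expect] using this

theorem expect_pos {E : Type*} [Fintype E] {p : ℝ} (h0 : 0 < p) (h1 : p ≤ 1)
    {f : (E → Bool) → ℝ} (h : ∀ ω, 0 ≤ f ω) (htrue : 0 < f fun _ => true) :
    0 < expect p f := by
  refine Finset.sum_pos' (fun ω _ => mul_nonneg (Finset.prod_nonneg fun e _ => ?_) (h ω))
    ⟨fun _ => true, Finset.mem_univ _, mul_pos (Finset.prod_pos fun e _ => ?_) htrue⟩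
  · split_ifs <;> linarith
  · simpa using h0

theorem expect_sum {E ι : Type*} [Fintype E] (p : ℝ) (s : Finset ι) (f : ι → (E → Bool) → ℝ) :
    expect p (fun ω => ∑ i ∈ s, f i ω) = ∑ i ∈ s, expect p (f i) := by
  simp_rw [expect, Finset.mul_sum]
  exact Finset.sum_comm

theorem expect_const_mul {E : Type*} [Fintype E] (p c : ℝ) (f : (E → Bool) → ℝ) :
    expect p (fun ω => c * f ω) = c * expect p f := by
  simp_rw [expect, Finset.mul_sum]
  exact Finset.sum_congr rfl fun _ _ => by ring

/-- Functions of disjoint sets of coordinates are independent. In two independent copies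
`(ω, ω')`, exchanging the coordinates in `A` preserves the joint weight and turns
`f ω * g ω'` into `f ω * g ω`. -/
theorem expect_mul {E : Type*} [Fintype E] (p : ℝ) {f g : (E → Bool) → ℝ} {A B : Set E}
    (hf : DependsOn f A) (hg : DependsOn g B) (hAB : Disjoint A B) :
    expect p (fun ω => f ω * g ω) = expect p f * expect p g := by
  set w : (E → Bool) → ℝ := fun ω => ∏ e, if ω e = true then p else 1 - p with hw
  let σ : (E → Bool) × (E → Bool) → (E → Bool) × (E → Bool) :=
    fun z => (A.piecewise z.1 z.2, A.piecewise z.2 z.1)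
  have hσ : Function.Involutive σ := by
    rintro ⟨a, b⟩
    ext e <;> by_cases h : e ∈ A <;> simp [σ, h]
  have hwσ : ∀ z, w (σ z).1 * w (σ z).2 = w z.1 * w z.2 := by
    intro z
    simp only [hw, ← Finset.prod_mul_distrib]
    refine Finset.prod_congr rfl fun e _ => ?_
    by_cases h : e ∈ A <;> simp [σ, h, mul_comm]
  have h1 : expect p f * expect p g =
      ∑ z : (E → Bool) × (E → Bool), w z.1 * w z.2 * (f z.1 * g z.2) := by
    rw [expect, expect, Finset.sum_mul_sum, ← Finset.univ_product_univ, Finset.sum_product]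
    exact Finset.sum_congr rfl fun _ _ => Finset.sum_congr rfl fun _ _ => by simp only [hw]; ring
  have h2 : expect p (fun ω => f ω * g ω) * expect (E := E) p (fun _ => 1) =
      ∑ z : (E → Bool) × (E → Bool), w z.1 * w z.2 * (f z.1 * g z.1) := by
    rw [expect, expect, Finset.sum_mul_sum, ← Finset.univ_product_univ, Finset.sum_product]
    exact Finset.sum_congr rfl fun _ _ => Finset.sum_congr rfl fun _ _ => by simp only [hw]; ring
  rw [expect_one, mul_one] at h2
  rw [h1, h2, ← Equiv.sum_comp hσ.toPerm]
  refine Finset.sum_congr rfl fun z _ => ?_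
  have e1 : f (σ z).1 = f z.1 := hf fun e he => by simp [σ, he]
  have e2 : g (σ z).1 = g z.2 := hg fun e he => by
    simp [σ, Set.disjoint_right.1 hAB he]
  simp only [Function.Involutive.coe_toPerm]
  rw [hwσ, e1, e2]

end

/-! ### Attachment to a set of roots -/

section
open scoped Classical

variable {V : Type*}

/-- The graph on the whole of `V` whose edges are the edges of `G` with both ends in `T`. -/
def within (G : SimpleGraph V) (T : Finset V) : SimpleGraph V where
  Adj a b := G.Adj a b ∧ a ∈ T ∧ b ∈ T
  symm := ⟨fun _ _ h => ⟨h.1.symm, h.2.2, h.2.1⟩⟩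
  loopless := ⟨fun _ h => h.1.ne rfl⟩

theorem within_mono (G : SimpleGraph V) {S T : Finset V} (h : S ⊆ T) : within G S ≤ within G T :=
  fun _ _ hab => ⟨hab.1, h hab.2.1, h hab.2.2⟩

theorem within_univ [Fintype V] (G : SimpleGraph V) : within G Finset.univ = G := by
  ext a b
  simp [within]

/-- Every vertex of `S` is joined to `R` by a path of `G` that stays in `R ∪ S`. -/
def AttachedTo (G : SimpleGraph V) (R S : Finset V) : Prop :=
  ∀ v ∈ S, ∃ a ∈ R, (within G (R ∪ S)).Reachable v a

/-- Exploring the root `r`: its neighbours in `S` become roots, and `r` is discarded. -/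
theorem attachedTo_iff_explore (G : SimpleGraph V) {R S J : Finset V} {r : V} (hr : r ∈ R)
    (hRS : Disjoint R S) (hJS : J ⊆ S) (hJ : ∀ v ∈ S, v ∈ J ↔ G.Adj r v) :
    AttachedTo G R S ↔ AttachedTo G (R.erase r ∪ J) (S \ J) := by
  have hrS : r ∉ S := Finset.disjoint_left.1 hRS hr
  have hU : R.erase r ∪ J ∪ S \ J = (R ∪ S).erase r := by
    ext v
    simp only [Finset.mem_union, Finset.mem_erase, Finset.mem_sdiff]
    by_cases hv : v = r
    · subst hv
      simp [hrS, show v ∉ J from fun h => hrS (hJS h)]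
    · have := @hJS v
      tauto
  unfold AttachedTo
  rw [hU]
  constructor
  · intro h v hv
    obtain ⟨hvS, hvJ⟩ := Finset.mem_sdiff.1 hv
    obtain ⟨a, ha, hva⟩ := h v hvS
    rw [SimpleGraph.reachable_iff_reflTransGen] at hva
    have key : ∀ w, Relation.ReflTransGen (within G (R ∪ S)).Adj w a → w ∈ R ∪ S → w ≠ r →
        ∃ b ∈ R.erase r ∪ J, (within G ((R ∪ S).erase r)).Reachable w b := by
      intro w hw
      induction hw using Relation.ReflTransGen.head_induction_on with
      | refl =>
        intro _ hne
        exact ⟨a, by simp [hne, ha], SimpleGraph.Reachable.refl _⟩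
      | @head w w' hww' _ ih =>
        intro hw hne
        by_cases hw'r : w' = r
        · subst hw'r
          refine ⟨w, ?_, SimpleGraph.Reachable.refl _⟩
          rcases Finset.mem_union.1 hw with hwR | hwS
          · simp [hne, hwR]
          · exact Finset.mem_union_right _ ((hJ w hwS).2 hww'.1.symm)
        · obtain ⟨b, hb, hwb⟩ := ih hww'.2.2 hw'r
          refine ⟨b, hb, SimpleGraph.Reachable.trans (SimpleGraph.Adj.reachable ?_) hwb⟩
          exact ⟨hww'.1, by simp [hne, hw], Finset.mem_erase.2 ⟨hw'r, hww'.2.2⟩⟩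
    exact key v hva (Finset.mem_union_right _ hvS) (fun h => hrS (h ▸ hvS))
  · intro h v hvS
    have hadj : ∀ b ∈ J, (within G (R ∪ S)).Reachable b r := fun b hb =>
      SimpleGraph.Adj.reachable ⟨((hJ b (hJS hb)).1 hb).symm,
        Finset.mem_union_right _ (hJS hb), Finset.mem_union_left _ hr⟩
    by_cases hvJ : v ∈ J
    · exact ⟨r, hr, hadj v hvJ⟩
    · obtain ⟨b, hb, hvb⟩ := h v (Finset.mem_sdiff.2 ⟨hvS, hvJ⟩)
      have hvb' := hvb.mono (within_mono G (Finset.erase_subset r (R ∪ S)))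
      rcases Finset.mem_union.1 hb with hb | hb
      · exact ⟨b, Finset.mem_of_mem_erase hb, hvb'⟩
      · exact ⟨r, hr, hvb'.trans (hadj b hb)⟩

theorem openGraph_adj (ω : Config (⊤ : SimpleGraph V)) {a b : V} (hab : a ≠ b) :
    (openGraph ω).Adj a b ↔ ω ⟨s(a, b), by simpa using hab⟩ = true := by
  simp [openGraph, hab]

/-- The edges with both ends in `T`. -/
def edgesIn (T : Finset V) : Set (⊤ : SimpleGraph V).edgeSet := {e | ∀ v ∈ e.1, v ∈ T}

theorem within_openGraph_congr {ω ω' : Config (⊤ : SimpleGraph V)} {T : Finset V}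
    (h : ∀ e ∈ edgesIn T, ω e = ω' e) :
    within (openGraph ω) T = within (openGraph ω') T := by
  ext a b
  by_cases hab : a = b
  · subst hab
    simp
  · simp only [within, openGraph_adj _ hab]
    refine and_congr_left fun hT => ?_
    rw [h]
    intro v hv
    rcases Sym2.mem_iff.1 hv with rfl | rfl
    exacts [hT.1, hT.2]

variable [Fintype V]

/-- The edges with one end in `A` and the other in `B`. -/
noncomputable def edgesBetween (A B : Finset V) : Finset (⊤ : SimpleGraph V).edgeSet :=
  {e | ∃ a ∈ A, ∃ b ∈ B, e.1 = s(a, b)}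

theorem mem_edgesBetween {A B : Finset V} {e : (⊤ : SimpleGraph V).edgeSet} :
    e ∈ edgesBetween A B ↔ ∃ a ∈ A, ∃ b ∈ B, e.1 = s(a, b) := by
  simp [edgesBetween]

theorem card_edgesBetween {A B : Finset V} (hAB : Disjoint A B) :
    (edgesBetween A B).card = A.card * B.card := by
  rw [← Finset.card_product]
  symm
  have hne : ∀ z ∈ A ×ˢ B, z.1 ≠ z.2 := fun z hz h =>
    Finset.disjoint_left.1 hAB (Finset.mem_product.1 hz).1 (h ▸ (Finset.mem_product.1 hz).2)
  refine Finset.card_bij (fun z hz => ⟨s(z.1, z.2), by simpa using hne z hz⟩) ?_ ?_ ?_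
  · intro z hz
    rw [Finset.mem_product] at hz
    exact mem_edgesBetween.2 ⟨z.1, hz.1, z.2, hz.2, rfl⟩
  · rintro ⟨a, b⟩ hz ⟨a', b'⟩ hz' h
    rw [Finset.mem_product] at hz hz'
    rcases Sym2.eq_iff.1 (Subtype.ext_iff.1 h) with h | h
    · exact Prod.ext h.1 h.2
    · exact absurd (h.1 ▸ hz'.2) (Finset.disjoint_left.1 hAB hz.1)
  · rintro ⟨e, he⟩ h
    obtain ⟨a, ha, b, hb, hab⟩ := mem_edgesBetween.1 h
    exact ⟨(a, b), Finset.mem_product.2 ⟨ha, hb⟩, Subtype.ext hab.symm⟩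

theorem forall_edgesBetween {A B : Finset V}
    {P : (⊤ : SimpleGraph V).edgeSet → Prop} :
    (∀ e ∈ edgesBetween A B, P e) ↔
      ∀ a ∈ A, ∀ b ∈ B, ∀ h : a ≠ b, P ⟨s(a, b), by simpa using h⟩ := by
  constructor
  · intro h a ha b hb hab
    exact h _ (mem_edgesBetween.2 ⟨a, ha, b, hb, rfl⟩)
  · rintro h ⟨e, he⟩ hm
    obtain ⟨a, ha, b, hb, hab⟩ := mem_edgesBetween.1 hm
    dsimp only at hab
    subst hab
    exact h a ha b hb (by simpa using he)

theorem edgesBetween_open {A B : Finset V} (hAB : Disjoint A B)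
    (ω : Config (⊤ : SimpleGraph V)) :
    (∀ e ∈ edgesBetween A B, ω e = true) ↔ ∀ a ∈ A, ∀ b ∈ B, (openGraph ω).Adj a b := by
  rw [forall_edgesBetween]
  refine forall₂_congr fun a ha => forall₂_congr fun b hb => ?_
  have hab : a ≠ b := fun h => Finset.disjoint_left.1 hAB ha (h ▸ hb)
  rw [openGraph_adj ω hab]
  exact ⟨fun h => h hab, fun h _ => h⟩

theorem edgesBetween_closed {A B : Finset V} (hAB : Disjoint A B)
    (ω : Config (⊤ : SimpleGraph V)) :
    (∀ e ∈ edgesBetween A B, ω e = false) ↔ ∀ a ∈ A, ∀ b ∈ B, ¬ (openGraph ω).Adj a b := by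
  rw [forall_edgesBetween]
  refine forall₂_congr fun a ha => forall₂_congr fun b hb => ?_
  have hab : a ≠ b := fun h => Finset.disjoint_left.1 hAB ha (h ▸ hb)
  rw [openGraph_adj ω hab, Bool.not_eq_true]
  exact ⟨fun h => h hab, fun h _ => h⟩

/-- The probability that every vertex of `S` is attached to `R`. -/
noncomputable def attachProb (p : ℝ) (R S : Finset V) : ℝ :=
  expect p fun ω : Config (⊤ : SimpleGraph V) =>
    if AttachedTo (openGraph ω) R S then 1 else 0

/-- Exploring the root `r` reveals which vertices of `S` are its neighbours; given this, the event
concerns only the unexplored edges. -/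
theorem attachProb_explore (p : ℝ) {R S : Finset V} {r : V} (hr : r ∈ R) (hRS : Disjoint R S) :
    attachProb p R S = ∑ J ∈ S.powerset,
      p ^ J.card * (1 - p) ^ (S.card - J.card) * attachProb p (R.erase r ∪ J) (S \ J) := by
  have hrS : r ∉ S := Finset.disjoint_left.1 hRS hr
  have hd : ∀ {J}, J ⊆ S → Disjoint {r} J := fun h => by
    simpa using fun h' => hrS (h h')
  let cyl : Finset V → Config (⊤ : SimpleGraph V) → Prop := fun J ω =>
    (∀ e ∈ edgesBetween {r} J, ω e = true) ∧ (∀ e ∈ edgesBetween {r} (S \ J), ω e = false)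
  have hcyl : ∀ ω, ∀ J ⊆ S, cyl J ω ↔ ∀ v ∈ S, v ∈ J ↔ (openGraph ω).Adj r v := by
    intro ω J hJ
    simp only [cyl, edgesBetween_open (hd hJ), edgesBetween_closed (hd Finset.sdiff_subset),
      Finset.mem_singleton, forall_eq, Finset.mem_sdiff]
    constructor
    · intro h v hv
      exact ⟨h.1 v, fun hv' => by_contra fun hn => h.2 v ⟨hv, hn⟩ hv'⟩
    · intro h
      exact ⟨fun v hv => (h v (hJ hv)).1 hv, fun v hv hv' => hv.2 ((h v hv.1).2 hv')⟩
  have hsum : ∀ ω : Config (⊤ : SimpleGraph V),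
      (if AttachedTo (openGraph ω) R S then (1 : ℝ) else 0) = ∑ J ∈ S.powerset,
        (if cyl J ω then 1 else 0) *
          (if AttachedTo (openGraph ω) (R.erase r ∪ J) (S \ J) then 1 else 0) := by
    intro ω
    rw [Finset.sum_eq_single (S.filter fun v => (openGraph ω).Adj r v)]
    · have hJ : ∀ v ∈ S, v ∈ (S.filter fun v => (openGraph ω).Adj r v) ↔
          (openGraph ω).Adj r v := fun v hv => by simp [hv]
      rw [if_pos ((hcyl ω _ (Finset.filter_subset _ _)).2 hJ), one_mul]
      exact if_congr (attachedTo_iff_explore _ hr hRS (Finset.filter_subset _ _) hJ) rfl rfl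
    · intro J hJS hne
      rw [if_neg, zero_mul]
      intro h
      rw [Finset.mem_powerset] at hJS
      rw [hcyl ω J hJS] at h
      apply hne
      ext v
      rw [Finset.mem_filter]
      exact ⟨fun hv => ⟨hJS hv, (h v (hJS hv)).1 hv⟩, fun hv => (h v hv.1).2 hv.2⟩
    · intro h
      simp at h
  unfold attachProb
  simp_rw [hsum]
  rw [expect_sum]
  refine Finset.sum_congr rfl fun J hJ => ?_
  rw [Finset.mem_powerset] at hJ
  rw [expect_mul p (A := {e | r ∈ e.1}) (B := edgesIn ((R ∪ S).erase r))]
  · have hF : Disjoint (edgesBetween {r} J) (edgesBetween {r} (S \ J)) := ?_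
    · have hc := expect_cylinder p hF
      rw [card_edgesBetween (hd hJ), card_edgesBetween (hd Finset.sdiff_subset),
        Finset.card_sdiff_of_subset hJ, Finset.card_singleton, one_mul, one_mul] at hc
      rw [← hc]
      congr!
    rw [Finset.disjoint_left]
    intro e he he'
    obtain ⟨a, ha, b, hb, hab⟩ := mem_edgesBetween.1 he
    obtain ⟨a', ha', b', hb', hab'⟩ := mem_edgesBetween.1 he'
    rw [Finset.mem_singleton] at ha ha'
    subst ha ha'
    rw [hab, Sym2.congr_right] at hab'
    exact (Finset.mem_sdiff.1 hb').2 (hab' ▸ hb)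
  · intro ω ω' h
    have hr' : ∀ B : Finset V, ∀ e ∈ edgesBetween {r} B, ω e = ω' e := by
      intro B e he
      obtain ⟨a, ha, b, hb, hab⟩ := mem_edgesBetween.1 he
      rw [Finset.mem_singleton] at ha
      subst ha
      exact h e (by simp [hab])
    refine if_congr (and_congr ?_ ?_) rfl rfl
    · exact forall₂_congr fun e he => by rw [hr' _ e he]
    · exact forall₂_congr fun e he => by rw [hr' _ e he]
  · intro ω ω' h
    have hU : R.erase r ∪ J ∪ S \ J ⊆ (R ∪ S).erase r := by
      intro v
      simp only [Finset.mem_union, Finset.mem_erase, Finset.mem_sdiff]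
      rintro ((hv | hv) | hv)
      · exact ⟨hv.1, Or.inl hv.2⟩
      · exact ⟨fun h => hrS (h ▸ hJ hv), Or.inr (hJ hv)⟩
      · exact ⟨fun h => hrS (h ▸ hv.1), Or.inr hv.1⟩
    have hw := within_openGraph_congr (ω := ω) (ω' := ω') (T := R.erase r ∪ J ∪ S \ J)
      fun e he => h e fun v hv => hU (he v hv)
    refine if_congr ?_ rfl rfl
    simp only [AttachedTo, hw]
  · rw [Set.disjoint_left]
    intro e he he'
    exact absurd rfl (Finset.mem_erase.1 (he' r he)).1

theorem attachProb_empty_roots (p : ℝ) {S : Finset V} (hS : S.Nonempty) :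
    attachProb p ∅ S = 0 := by
  obtain ⟨v, hv⟩ := hS
  have : ∀ ω : Config (⊤ : SimpleGraph V), ¬ AttachedTo (openGraph ω) ∅ S := fun ω h => by
    simpa using h v hv
  simp [attachProb, this, expect]

theorem attachProb_empty (p : ℝ) (R : Finset V) : attachProb p R ∅ = 1 := by
  have : ∀ ω : Config (⊤ : SimpleGraph V), AttachedTo (openGraph ω) R ∅ := fun ω h => by simp
  simp only [attachProb, this, if_true, expect_one]

theorem attachProb_nonneg {p : ℝ} (h0 : 0 ≤ p) (h1 : p ≤ 1) (R S : Finset V) :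
    0 ≤ attachProb p R S :=
  expect_nonneg h0 h1 fun ω => by split_ifs <;> norm_num

omit [Fintype V] in
theorem card_explore {R S J : Finset V} {r : V} (hr : r ∈ R) (hRS : Disjoint R S) (hJ : J ⊆ S) :
    (R.erase r ∪ J).card = R.card - 1 + J.card ∧ (S \ J).card = S.card - J.card ∧
      Disjoint (R.erase r ∪ J) (S \ J) := by
  refine ⟨?_, Finset.card_sdiff_of_subset hJ, ?_⟩
  · rw [Finset.card_union_of_disjoint, Finset.card_erase_of_mem hr]
    exact (hRS.mono_left (Finset.erase_subset _ _)).mono_right hJ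
  · rw [Finset.disjoint_union_left]
    exact ⟨(hRS.mono_left (Finset.erase_subset _ _)).mono_right Finset.sdiff_subset,
      Finset.disjoint_sdiff⟩

/-- Every term of the exploration recursion is bounded by induction, and the binomial theorem sums
these bounds exactly, because `p + x * (1 - x ^ N) = 1 - x ^ (N + 1)` for `x = 1 - p`. -/
theorem attachProb_le {p : ℝ} (h0 : 0 ≤ p) (h1 : p ≤ 1) {R S : Finset V} (hRS : Disjoint R S) :
    attachProb p R S ≤ (1 - (1 - p) ^ (R.card + S.card)) ^ S.card := by
  have hx : 0 ≤ 1 - p := by linarith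
  induction hN : R.card + S.card generalizing R S with
  | zero =>
    have hS : S = ∅ := Finset.card_eq_zero.1 (by omega)
    simp [hS, attachProb_empty]
  | succ N ih =>
    rcases R.eq_empty_or_nonempty with rfl | ⟨r, hr⟩
    · have hS : S.Nonempty := Finset.card_pos.1 (by simp at hN; omega)
      rw [attachProb_empty_roots p hS]
      have := pow_le_one₀ (n := N + 1) hx (by linarith)
      exact pow_nonneg (by linarith) _
    · rw [attachProb_explore p hr hRS]
      have hR : 0 < R.card := Finset.card_pos.2 ⟨r, hr⟩
      calc _ ≤ ∑ J ∈ S.powerset,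
            p ^ J.card * ((1 - p) * (1 - (1 - p) ^ N)) ^ (S.card - J.card) := by
            refine Finset.sum_le_sum fun J hJ => ?_
            rw [Finset.mem_powerset] at hJ
            obtain ⟨c1, c2, c3⟩ := card_explore hr hRS hJ
            have hle := Finset.card_le_card hJ
            have := ih c3 (by omega)
            rw [c2] at this
            rw [mul_pow, ← mul_assoc]
            exact mul_le_mul_of_nonneg_left this (by positivity)
        _ = (1 - (1 - p) ^ (N + 1)) ^ S.card := by
            rw [Finset.sum_pow_mul_eq_add_pow]
            ring

/-- The mean of a binomial variable, written as a sum over subsets. -/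
theorem sum_card_mul_pow_mul_pow {ι : Type*} (a b : ℝ) (S : Finset ι) :
    ∑ J ∈ S.powerset, (J.card : ℝ) * (a ^ J.card * b ^ (S.card - J.card)) =
      S.card * a * (a + b) ^ (S.card - 1) := by
  induction S using Finset.induction_on with
  | empty => simp
  | insert v S hv ih =>
    have e1 : ∑ J ∈ S.powerset, (J.card : ℝ) * (a ^ J.card * b ^ ((insert v S).card - J.card)) =
        b * ∑ J ∈ S.powerset, (J.card : ℝ) * (a ^ J.card * b ^ (S.card - J.card)) := by
      rw [Finset.mul_sum]
      refine Finset.sum_congr rfl fun J hJ => ?_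
      have := Finset.card_le_card (Finset.mem_powerset.1 hJ)
      rw [Finset.card_insert_of_notMem hv, Nat.sub_add_comm this, pow_succ]
      ring
    have e2 : ∑ J ∈ S.powerset, ((insert v J).card : ℝ) *
          (a ^ (insert v J).card * b ^ ((insert v S).card - (insert v J).card)) =
        a * (∑ J ∈ S.powerset, (J.card : ℝ) * (a ^ J.card * b ^ (S.card - J.card))) +
          a * ∑ J ∈ S.powerset, a ^ J.card * b ^ (S.card - J.card) := by
      rw [Finset.mul_sum, Finset.mul_sum, ← Finset.sum_add_distrib]
      refine Finset.sum_congr rfl fun J hJ => ?_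
      have hvJ : v ∉ J := fun h => hv (Finset.mem_powerset.1 hJ h)
      rw [Finset.card_insert_of_notMem hv, Finset.card_insert_of_notMem hvJ,
        Nat.add_sub_add_right, pow_succ]
      push_cast
      ring
    rw [Finset.sum_powerset_insert hv, e1, e2, ih, Finset.sum_pow_mul_eq_add_pow,
      Finset.card_insert_of_notMem hv]
    rcases Nat.eq_zero_or_pos S.card with h | h
    · simp [h]
    · obtain ⟨k, hk⟩ := Nat.exists_eq_add_of_lt h
      rw [hk]
      simp only [zero_add, Nat.add_sub_cancel]
      push_cast
      ring

/-- The upper bound `attachProb_le` is sharp up to the factor `|R| / (|R| + |S|)`. The factor is that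
of the ballot theorem, and it survives the induction on the exploration thanks to Bernoulli's
inequality `1 - (1 - p) ^ N ≤ N * p`. -/
theorem le_attachProb {p : ℝ} (h0 : 0 ≤ p) (h1 : p ≤ 1) {R S : Finset V} (hRS : Disjoint R S) :
    (R.card / (R.card + S.card : ℕ) : ℝ) * (1 - (1 - p) ^ (R.card + S.card)) ^ S.card ≤
      attachProb p R S := by
  have hx : 0 ≤ 1 - p := by linarith
  induction hN : R.card + S.card generalizing R S with
  | zero => simpa using attachProb_nonneg h0 h1 R S
  | succ N ih =>
    rcases R.eq_empty_or_nonempty with rfl | ⟨r, hr⟩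
    · simpa using attachProb_nonneg h0 h1 ∅ S
    have hR : 0 < R.card := Finset.card_pos.2 ⟨r, hr⟩
    rcases S.eq_empty_or_nonempty with rfl | hS
    · rw [attachProb_empty]
      simp only [Finset.card_empty, add_zero] at hN
      rw [hN, div_self (by positivity)]
      simp
    have hm : 0 < S.card := Finset.card_pos.2 hS
    have hN0 : (0 : ℝ) < N := by exact_mod_cast (by omega : 0 < N)
    have hcard : (R.card : ℝ) + S.card = N + 1 := by exact_mod_cast hN
    rw [attachProb_explore p hr hRS]
    set Y : ℝ := 1 - (1 - p) ^ (N + 1) with hY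
    have hY0 : 0 ≤ Y := by
      have := pow_le_one₀ (n := N + 1) hx (by linarith)
      linarith
    -- Bernoulli's inequality
    have hYp : Y ≤ (N + 1) * p := by
      have := one_add_mul_le_pow (a := -p) (by linarith) (N + 1)
      push_cast at this
      rw [← sub_eq_add_neg] at this
      linarith
    calc R.card / ((N + 1 : ℕ) : ℝ) * Y ^ S.card
        ≤ ((R.card - 1) * Y ^ S.card + S.card * p * Y ^ (S.card - 1)) / N := by
          obtain ⟨k, hk⟩ : ∃ k, S.card = k + 1 := ⟨S.card - 1, by omega⟩
          have hk' : (S.card : ℝ) = k + 1 := by exact_mod_cast hk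
          rw [div_mul_eq_mul_div, div_le_div_iff₀ (by positivity) hN0, hk, Nat.add_sub_cancel,
            pow_succ]
          have hYk : 0 ≤ Y ^ k := by positivity
          have : 0 ≤ Y ^ k * ((S.card : ℝ) * ((N + 1) * p - Y)) := by
            have : 0 ≤ (N + 1) * p - Y := by linarith
            positivity
          have hr' : (R.card : ℝ) = N + 1 - S.card := by linarith
          push_cast
          rw [hr', ← hk']
          nlinarith [this]
      _ = ∑ J ∈ S.powerset, (((R.card : ℝ) - 1) / N *
            (p ^ J.card * ((1 - p) * (1 - (1 - p) ^ N)) ^ (S.card - J.card)) +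
            (J.card * (p ^ J.card * ((1 - p) * (1 - (1 - p) ^ N)) ^ (S.card - J.card))) / N) := by
          rw [Finset.sum_add_distrib, ← Finset.mul_sum, ← Finset.sum_div,
            Finset.sum_pow_mul_eq_add_pow, sum_card_mul_pow_mul_pow]
          have : p + (1 - p) * (1 - (1 - p) ^ N) = Y := by rw [hY]; ring
          rw [this]
          ring
      _ ≤ _ := by
          refine Finset.sum_le_sum fun J hJ => ?_
          rw [Finset.mem_powerset] at hJ
          obtain ⟨c1, c2, c3⟩ := card_explore hr hRS hJ
          have hle := Finset.card_le_card hJ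
          have := ih c3 (by omega)
          rw [c2, c1] at this
          refine le_trans (le_of_eq ?_) (mul_le_mul_of_nonneg_left this (by positivity))
          rw [mul_pow]
          push_cast [Nat.cast_sub (show 1 ≤ R.card from hR)]
          ring

end

/-! ### Components and their weighted sums -/

section
open scoped Classical

variable {V : Type*}

/-- The vertex set `A` induces a connected subgraph of `G` (or is empty). -/
def ConnectedIn (G : SimpleGraph V) (A : Finset V) : Prop :=
  ∀ a ∈ A, ∀ b ∈ A, (within G A).Reachable a b

/-- Connectedness is the case of a single root. -/
theorem attachedTo_singleton_iff (G : SimpleGraph V) {A : Finset V} {u : V} (hu : u ∈ A) :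
    AttachedTo G {u} (A.erase u) ↔ ConnectedIn G A := by
  have hA : {u} ∪ A.erase u = A := by
    rw [← Finset.insert_eq, Finset.insert_erase hu]
  unfold AttachedTo ConnectedIn
  rw [hA]
  constructor
  · intro h
    have key : ∀ v ∈ A, (within G A).Reachable v u := fun v hv => by
      by_cases hvu : v = u
      · rw [hvu]
      · obtain ⟨a, ha, hva⟩ := h v (Finset.mem_erase.2 ⟨hvu, hv⟩)
        rwa [Finset.mem_singleton.1 ha] at hva
    exact fun a ha b hb => (key a ha).trans (key b hb).symm
  · exact fun h v hv => ⟨u, Finset.mem_singleton_self u, h v (Finset.mem_of_mem_erase hv) u hu⟩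

/-- The vertices of `T` joined to `u` by a path of `G` inside `T`. -/
noncomputable def cluster (G : SimpleGraph V) (T : Finset V) (u : V) : Finset V :=
  T.filter fun v => (within G T).Reachable u v

theorem mem_cluster {G : SimpleGraph V} {T : Finset V} {u v : V} :
    v ∈ cluster G T u ↔ v ∈ T ∧ (within G T).Reachable u v := Finset.mem_filter

theorem cluster_subset (G : SimpleGraph V) (T : Finset V) (u : V) : cluster G T u ⊆ T :=
  Finset.filter_subset _ _

theorem self_mem_cluster (G : SimpleGraph V) {T : Finset V} {u : V} (hu : u ∈ T) :
    u ∈ cluster G T u := mem_cluster.2 ⟨hu, SimpleGraph.Reachable.refl u⟩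

theorem cluster_eq_of_mem {G : SimpleGraph V} {T : Finset V} {u v : V}
    (hv : v ∈ cluster G T u) : cluster G T v = cluster G T u := by
  have huv := (mem_cluster.1 hv).2
  ext w
  simp only [mem_cluster]
  exact and_congr_right fun _ => ⟨fun h => huv.trans h, fun h => huv.symm.trans h⟩

/-- A path inside `T` started in `A` stays in `A` if no edge joins `A` to `T \ A`. -/
theorem reachable_within_of_closed {G : SimpleGraph V} {A T : Finset V}
    (h : ∀ a ∈ A, ∀ b ∈ T \ A, ¬ G.Adj a b) {a w : V} (ha : a ∈ A)
    (haw : (within G T).Reachable a w) : w ∈ A ∧ (within G A).Reachable a w := by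
  rw [SimpleGraph.reachable_iff_reflTransGen] at haw
  induction haw with
  | refl => exact ⟨ha, SimpleGraph.Reachable.refl a⟩
  | @tail b c _ hbc ih =>
    have hc : c ∈ A := by
      by_contra hc
      exact h b ih.1 c (Finset.mem_sdiff.2 ⟨hbc.2.2, hc⟩) hbc.1
    exact ⟨hc, ih.2.trans (SimpleGraph.Adj.reachable ⟨hbc.1, ih.1, hc⟩)⟩

theorem not_adj_cluster (G : SimpleGraph V) (T : Finset V) (u : V) :
    ∀ a ∈ cluster G T u, ∀ b ∈ T \ cluster G T u, ¬ G.Adj a b := by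
  intro a ha b hb hab
  obtain ⟨haT, hua⟩ := mem_cluster.1 ha
  obtain ⟨hbT, hb⟩ := Finset.mem_sdiff.1 hb
  exact hb (mem_cluster.2 ⟨hbT, hua.trans (SimpleGraph.Adj.reachable ⟨hab, haT, hbT⟩)⟩)

theorem cluster_eq_iff {G : SimpleGraph V} {A T : Finset V} {u : V} (hA : A ⊆ T) (hu : u ∈ A) :
    cluster G T u = A ↔ ConnectedIn G A ∧ ∀ a ∈ A, ∀ b ∈ T \ A, ¬ G.Adj a b := by
  constructor
  · rintro rfl
    have h := not_adj_cluster G T u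
    refine ⟨fun a ha b hb => ?_, h⟩
    exact (reachable_within_of_closed h ha
      ((mem_cluster.1 ha).2.symm.trans (mem_cluster.1 hb).2)).2
  · rintro ⟨hc, h⟩
    ext v
    rw [mem_cluster]
    exact ⟨fun hv => (reachable_within_of_closed h hu hv.2).1,
      fun hv => ⟨hA hv, (hc u hu v hv).mono (within_mono G hA)⟩⟩

theorem cluster_sdiff {G : SimpleGraph V} {A T : Finset V}
    (h : ∀ a ∈ A, ∀ b ∈ T \ A, ¬ G.Adj a b) {v : V} (hv : v ∈ T \ A) :
    cluster G T v = cluster G (T \ A) v := by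
  have h' : ∀ a ∈ T \ A, ∀ b ∈ T \ (T \ A), ¬ G.Adj a b := by
    intro a ha b hb hab
    simp only [Finset.mem_sdiff, not_and, not_not] at hb
    exact h b (hb.2 hb.1) a ha hab.symm
  ext w
  simp only [mem_cluster]
  exact ⟨fun hw => reachable_within_of_closed h' hv hw.2,
    fun hw => ⟨Finset.sdiff_subset hw.1, hw.2.mono (within_mono G Finset.sdiff_subset)⟩⟩

/-- The vertex sets of the connected components of the subgraph of `G` induced on `T`. -/
noncomputable def clusters (G : SimpleGraph V) (T : Finset V) : Finset (Finset V) :=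
  T.image (cluster G T)

theorem clusters_eq_insert (G : SimpleGraph V) {T : Finset V} {u : V} (hu : u ∈ T) :
    clusters G T = insert (cluster G T u) (clusters G (T \ cluster G T u)) := by
  have h := not_adj_cluster G T u
  ext C
  simp only [clusters, Finset.mem_insert, Finset.mem_image]
  constructor
  · rintro ⟨v, hv, rfl⟩
    by_cases hvu : v ∈ cluster G T u
    · exact Or.inl (cluster_eq_of_mem hvu)
    · have hv' := Finset.mem_sdiff.2 ⟨hv, hvu⟩
      exact Or.inr ⟨v, hv', (cluster_sdiff h hv').symm⟩
  · rintro (rfl | ⟨v, hv, rfl⟩)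
    · exact ⟨u, hu, rfl⟩
    · exact ⟨v, Finset.sdiff_subset hv, cluster_sdiff h hv⟩

theorem cluster_notMem_clusters (G : SimpleGraph V) {T : Finset V} {u : V} (hu : u ∈ T) :
    cluster G T u ∉ clusters G (T \ cluster G T u) := by
  intro h
  obtain ⟨v, hv, hvu⟩ := Finset.mem_image.1 h
  have := cluster_subset G _ v (hvu ▸ self_mem_cluster G hu)
  exact (Finset.mem_sdiff.1 this).2 (self_mem_cluster G hu)

variable [Fintype V]

/-- The probability that `A` induces a connected subgraph. -/
noncomputable def connProb (p : ℝ) (A : Finset V) : ℝ :=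
  expect p fun ω : Config (⊤ : SimpleGraph V) => if ConnectedIn (openGraph ω) A then 1 else 0

theorem connProb_eq_attachProb (p : ℝ) {A : Finset V} {u : V} (hu : u ∈ A) :
    connProb p A = attachProb p {u} (A.erase u) := by
  simp only [connProb, attachProb, attachedTo_singleton_iff _ hu]

omit [Fintype V] in
theorem card_add_card_erase {A : Finset V} {u : V} (hu : u ∈ A) :
    ({u} : Finset V).card + (A.erase u).card = A.card := by
  have := Finset.card_pos.2 ⟨u, hu⟩
  rw [Finset.card_erase_of_mem hu, Finset.card_singleton]
  omega

theorem connProb_le {p : ℝ} (h0 : 0 ≤ p) (h1 : p ≤ 1) {A : Finset V} (hA : A.Nonempty) :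
    connProb p A ≤ (1 - (1 - p) ^ A.card) ^ (A.card - 1) := by
  obtain ⟨u, hu⟩ := hA
  have := attachProb_le h0 h1 (R := {u}) (S := A.erase u) (by simp)
  rwa [card_add_card_erase hu, Finset.card_erase_of_mem hu, ← connProb_eq_attachProb p hu] at this

theorem le_connProb {p : ℝ} (h0 : 0 ≤ p) (h1 : p ≤ 1) {A : Finset V} (hA : A.Nonempty) :
    (1 / A.card : ℝ) * (1 - (1 - p) ^ A.card) ^ (A.card - 1) ≤ connProb p A := by
  obtain ⟨u, hu⟩ := hA
  have := le_attachProb h0 h1 (R := {u}) (S := A.erase u) (by simp)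
  rw [card_add_card_erase hu, Finset.card_erase_of_mem hu, ← connProb_eq_attachProb p hu] at this
  simpa using this

theorem connProb_nonneg {p : ℝ} (h0 : 0 ≤ p) (h1 : p ≤ 1) (A : Finset V) : 0 ≤ connProb p A :=
  expect_nonneg h0 h1 fun ω => by split_ifs <;> norm_num

/-- The expectation of `∏ g(C)` over the components `C` of the subgraph induced on `T`. -/
noncomputable def clusterSum (p : ℝ) (g : Finset V → ℝ) (T : Finset V) : ℝ :=
  expect p fun ω : Config (⊤ : SimpleGraph V) => ∏ C ∈ clusters (openGraph ω) T, g C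

theorem clusterSum_nonneg {p : ℝ} (h0 : 0 ≤ p) (h1 : p ≤ 1) {g : Finset V → ℝ}
    (hg : ∀ A, 0 ≤ g A) (T : Finset V) : 0 ≤ clusterSum p g T :=
  expect_nonneg h0 h1 fun _ => Finset.prod_nonneg fun _ _ => hg _

/-- The contribution to `clusterSum p g T` of the configurations in which the component of `u`
is `A`. Such configurations are given by independent choices inside `A` (connected), between `A`
and `T \ A` (all closed), and inside `T \ A`. -/
theorem expect_cluster_eq (p : ℝ) (g : Finset V → ℝ) {A T : Finset V} {u : V} (hA : A ⊆ T)
    (hu : u ∈ A) :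
    expect p (fun ω : Config (⊤ : SimpleGraph V) =>
        (if cluster (openGraph ω) T u = A then 1 else 0) *
          ∏ C ∈ clusters (openGraph ω) T, g C) =
      g A * (connProb p A * (1 - p) ^ (A.card * (T.card - A.card)) * clusterSum p g (T \ A)) := by
  have h1 : ∀ ω : Config (⊤ : SimpleGraph V),
      (if cluster (openGraph ω) T u = A then (1 : ℝ) else 0) *
          ∏ C ∈ clusters (openGraph ω) T, g C =
        g A * (((if ConnectedIn (openGraph ω) A then 1 else 0) *
          (if (∀ e ∈ (∅ : Finset (⊤ : SimpleGraph V).edgeSet), ω e = true) ∧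
            (∀ e ∈ edgesBetween A (T \ A), ω e = false) then 1 else 0)) *
          ∏ C ∈ clusters (openGraph ω) (T \ A), g C) := by
    intro ω
    have hclosed := edgesBetween_closed (A := A) (B := T \ A) Finset.disjoint_sdiff ω
    by_cases h : cluster (openGraph ω) T u = A
    · obtain ⟨hc, hd⟩ := (cluster_eq_iff hA hu).1 h
      have hn := cluster_notMem_clusters (openGraph ω) (hA hu)
      rw [clusters_eq_insert (openGraph ω) (hA hu), Finset.prod_insert hn, h, if_pos rfl,
        if_pos hc, if_pos ⟨by simp, hclosed.2 hd⟩]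
      ring
    · have h' := mt (cluster_eq_iff hA hu).2 h
      rw [if_neg h]
      by_cases hc : ConnectedIn (openGraph ω) A
      · have hd : ¬ ∀ e ∈ edgesBetween A (T \ A), ω e = false :=
          fun hd => h' ⟨hc, hclosed.1 hd⟩
        simp only [hd, and_false, if_false]
        ring
      · simp [hc]
  simp_rw [h1]
  rw [expect_const_mul]
  congr 1
  have hbet : ∀ e ∈ edgesBetween A (T \ A), e ∉ edgesIn A ∧ e ∉ edgesIn (T \ A) := by
    intro e he
    obtain ⟨a, ha, b, hb, hab⟩ := mem_edgesBetween.1 he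
    constructor
    · exact fun h => (Finset.mem_sdiff.1 hb).2 (h b (by simp [hab]))
    · exact fun h => (Finset.mem_sdiff.1 (h a (by simp [hab]))).2 ha
  have dconn : DependsOn (fun ω : Config (⊤ : SimpleGraph V) =>
      if ConnectedIn (openGraph ω) A then (1 : ℝ) else 0) (edgesIn A) := by
    intro ω ω' h
    refine if_congr ?_ rfl rfl
    rw [ConnectedIn, ConnectedIn, within_openGraph_congr h]
  have dbet : DependsOn (fun ω : Config (⊤ : SimpleGraph V) =>
      if (∀ e ∈ (∅ : Finset (⊤ : SimpleGraph V).edgeSet), ω e = true) ∧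
        (∀ e ∈ edgesBetween A (T \ A), ω e = false) then (1 : ℝ) else 0)
      (edgesBetween A (T \ A) : Set (⊤ : SimpleGraph V).edgeSet) := by
    intro ω ω' h
    refine if_congr (and_congr (by simp) ?_) rfl rfl
    exact forall₂_congr fun e he => by rw [h e he]
  have drest : DependsOn (fun ω : Config (⊤ : SimpleGraph V) =>
      ∏ C ∈ clusters (openGraph ω) (T \ A), g C) (edgesIn (T \ A)) := by
    intro ω ω' h
    have hw := within_openGraph_congr h
    have hcl : cluster (openGraph ω) (T \ A) = cluster (openGraph ω') (T \ A) := by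
      ext v w
      simp only [mem_cluster, hw]
    simp only [clusters, hcl]
  rw [expect_mul p (A := edgesIn A ∪ edgesBetween A (T \ A)) (B := edgesIn (T \ A)) ?_ drest,
    expect_mul p dconn dbet]
  · have hcyl := expect_cylinder p
      (Finset.disjoint_empty_left (edgesBetween A (T \ A)))
    rw [card_edgesBetween Finset.disjoint_sdiff, Finset.card_sdiff_of_subset hA,
      Finset.card_empty, pow_zero, one_mul] at hcyl
    rw [← hcyl]
    unfold connProb clusterSum
    congr!
  · exact Set.disjoint_right.2 fun e he => (hbet e he).1
  · rw [Set.disjoint_left]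
    rintro e (he | he) he'
    · obtain ⟨e, h⟩ := e
      induction e using Sym2.ind with
      | _ a b =>
        exact (Finset.mem_sdiff.1 (he' a (by simp))).2 (he a (by simp))
    · exact (hbet e he).2 he'
  · intro ω ω' h
    dsimp only
    congr 1
    · exact dconn fun e he => h e (Or.inl he)
    · exact dbet fun e he => h e (Or.inr he)

/-- Decomposition according to the component `A` of `u`. -/
theorem clusterSum_eq_sum (p : ℝ) (g : Finset V → ℝ) {T : Finset V} {u : V} (hu : u ∈ T) :
    clusterSum p g T = ∑ A ∈ T.powerset with u ∈ A,
      g A * (connProb p A * (1 - p) ^ (A.card * (T.card - A.card)) * clusterSum p g (T \ A)) := by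
  have : ∀ ω : Config (⊤ : SimpleGraph V), ∏ C ∈ clusters (openGraph ω) T, g C =
      ∑ A ∈ T.powerset with u ∈ A, (if cluster (openGraph ω) T u = A then 1 else 0) *
          ∏ C ∈ clusters (openGraph ω) T, g C := by
    intro ω
    rw [← Finset.sum_mul, Finset.sum_ite_eq, if_pos, one_mul]
    simp [cluster_subset, self_mem_cluster _ hu]
  refine (congrArg (expect p) (funext this)).trans ?_
  rw [expect_sum]
  refine Finset.sum_congr rfl fun A hA => ?_
  rw [Finset.mem_filter, Finset.mem_powerset] at hA
  exact expect_cluster_eq p g hA.1 hA.2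

end

/-! ### Splitting a connected set into two macroscopic pieces -/

section
open scoped Classical

theorem exp_neg_le_quadratic {h : ℝ} (hh : 0 ≤ h) : Real.exp (-h) ≤ 1 - h + h ^ 2 / 2 := by
  rw [Real.exp_neg, inv_le_comm₀ (Real.exp_pos h) (by nlinarith [sq_nonneg (h - 1)])]
  refine le_trans ?_ (Real.quadratic_le_exp_of_nonneg hh)
  rw [inv_le_iff_one_le_mul₀ (by nlinarith [sq_nonneg (h - 1)])]
  nlinarith [pow_nonneg hh 4]

/-- A Chernoff bound for a single binomial probability below the mean. -/
theorem choose_mul_pow_le_exp {s : ℝ} (h0 : 0 ≤ s) (h1 : s ≤ 1) {a m : ℕ} (ha : a ≤ m)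
    (hm : 0 < m) {h : ℝ} (hh : 0 ≤ h) (has : h ≤ s - a / m) :
    (m.choose a : ℝ) * (s ^ a * (1 - s) ^ (m - a)) ≤ Real.exp (-(m * h ^ 2 / 2)) := by
  -- The exponential moment method with parameter `-h`, which is optimal up to constants.
  have key : (m.choose a : ℝ) * ((s * Real.exp (-h)) ^ a * (1 - s) ^ (m - a)) ≤
      (s * Real.exp (-h) + (1 - s)) ^ m := by
    rw [add_pow]
    have h1s : 0 ≤ 1 - s := by linarith
    refine le_trans (le_of_eq ?_) (Finset.single_le_sum
      (f := fun k => (s * Real.exp (-h)) ^ k * (1 - s) ^ (m - k) * (m.choose k : ℝ))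
      (fun k _ => by positivity) (Finset.mem_range.2 (Nat.lt_succ_of_le ha)))
    ring
  have hbase : s * Real.exp (-h) + (1 - s) ≤ Real.exp (-s * h + h ^ 2 / 2) := by
    refine le_trans ?_ (Real.add_one_le_exp _)
    nlinarith [mul_le_mul_of_nonneg_left (exp_neg_le_quadratic hh) h0,
      mul_nonneg (sub_nonneg.2 h1) (sq_nonneg h)]
  have hpow : (s * Real.exp (-h) + (1 - s)) ^ m ≤ Real.exp (m * (-s * h + h ^ 2 / 2)) := by
    rw [Real.exp_nat_mul]
    have h1s : 0 ≤ 1 - s := by linarith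
    exact pow_le_pow_left₀ (by positivity) hbase m
  have hsplit : (m.choose a : ℝ) * (s ^ a * (1 - s) ^ (m - a)) = Real.exp (a * h) *
      ((m.choose a : ℝ) * ((s * Real.exp (-h)) ^ a * (1 - s) ^ (m - a))) := by
    have : Real.exp (a * h) * Real.exp (-h) ^ a = 1 := by
      rw [← Real.exp_nat_mul, ← Real.exp_add]
      simp
    rw [mul_pow]
    linear_combination -(m.choose a : ℝ) * (s ^ a * (1 - s) ^ (m - a)) * this
  rw [hsplit]
  refine (mul_le_mul_of_nonneg_left (key.trans hpow) (Real.exp_pos _).le).trans ?_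
  rw [← Real.exp_add, Real.exp_le_exp]
  have hm' : (0 : ℝ) < m := by exact_mod_cast hm
  have : (a : ℝ) ≤ m * (s - h) := by
    have : a / m ≤ s - h := by linarith
    rwa [div_le_iff₀' hm'] at this
  nlinarith [mul_le_mul_of_nonneg_right this hh]

theorem one_sub_pow_le_mul {p : ℝ} (h1 : p ≤ 1) (b : ℕ) :
    1 - (1 - p) ^ b ≤ b * p := by
  have := one_add_mul_le_pow (a := -p) (by linarith) b
  rw [← sub_eq_add_neg] at this
  linarith

theorem pow_le_exp_neg {p : ℝ} (h1 : p ≤ 1) (a : ℕ) :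
    (1 - p) ^ a ≤ Real.exp (-(a * p)) := by
  have := pow_le_pow_left₀ (by linarith) (Real.one_sub_le_exp_neg p) a
  rwa [← Real.exp_nat_mul, mul_neg] at this

/-- By strict concavity of `t ↦ 1 - x ^ t`, the success probability
`(1 - x ^ a) / (1 - x ^ (a + b))` exceeds the proportion `a / (a + b)`, by an amount quantified
by `κ`. -/
theorem gap_le {p κ : ℝ} (h1 : p ≤ 1) (hκ : 0 ≤ κ) {a b : ℕ}
    (hab : (0 : ℝ) < a + b)
    (hpos : 0 < 1 - (1 - p) ^ (a + b)) (ha : (1 - p) ^ a * (1 + a * p) ≤ 1 - κ) :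
    b / (a + b) * κ ≤ (1 - (1 - p) ^ a) / (1 - (1 - p) ^ (a + b)) - a / (a + b) := by
  rw [le_sub_iff_add_le, div_mul_eq_mul_div, ← add_div, div_le_div_iff₀ hab hpos]
  have hxa : 0 ≤ (1 - p) ^ a := pow_nonneg (by linarith) a
  have hxab : 0 ≤ (1 - p) ^ (a + b) := pow_nonneg (by linarith) _
  have hb := mul_le_mul_of_nonneg_left (one_sub_pow_le_mul h1 b)
    (mul_nonneg (Nat.cast_nonneg a : (0 : ℝ) ≤ a) hxa)
  have hb0 : (0 : ℝ) ≤ b := Nat.cast_nonneg b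
  have e1 := mul_le_mul_of_nonneg_left ha hb0
  have e2 : 0 ≤ b * κ * (1 - p) ^ (a + b) := by positivity
  rw [pow_add] at *
  nlinarith

/-- The ratio of the left side to `(1 - (1 - lam / n) ^ (a + b)) ^ (a + b - 1)` is, up to a constant
factor, the probability that a binomial variable takes the value `a`, which lies a
macroscopic distance below its mean. -/
theorem exists_pair_bound {lam ε : ℝ} (hlam : 0 < lam) (hε : 0 < ε) :
    ∃ D c : ℝ, 0 < D ∧ 0 < c ∧ ∀ n a b : ℕ, lam ≤ n → ε * n < a → ε * n < b → a + b ≤ n →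
      ((a + b).choose a : ℝ) * ((1 - (1 - lam / n) ^ a) ^ (a - 1) *
        (1 - (1 - lam / n) ^ b) ^ (b - 1) * (1 - lam / n) ^ (a * b)) ≤
        D * Real.exp (-(c * n)) * (1 - (1 - lam / n) ^ (a + b)) ^ (a + b - 1) := by
  set y := ε * lam with hy
  have hy0 : 0 < y := by positivity
  -- `κ` is a lower bound, uniform in `n` and `a`, for `1 - (1 - p) ^ a * (1 + a * p)`.
  set κ := 1 - Real.exp (-y) * (1 + y) with hκ
  have hκ0 : 0 < κ := by
    have h := Real.add_one_lt_exp hy0.ne'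
    have : Real.exp (-y) * (1 + y) < Real.exp (-y) * Real.exp y :=
      mul_lt_mul_of_pos_left (by linarith) (Real.exp_pos _)
    rw [← Real.exp_add, neg_add_cancel, Real.exp_zero] at this
    linarith
  -- `δ` is a lower bound for `1 - (1 - p) ^ k` as soon as `k > ε * n`.
  set δ := 1 - Real.exp (-y) with hδ
  have hδ0 : 0 < δ := by
    have : Real.exp (-y) < 1 := Real.exp_lt_one_iff.2 (by linarith)
    linarith
  refine ⟨1 / δ ^ 2, ε * (ε * κ) ^ 2 / 2, by positivity, by positivity, ?_⟩
  intro n a b hn ha hb hab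
  have hn0 : (0 : ℝ) < n := hlam.trans_le hn
  set p := lam / n with hp
  have hp0 : 0 ≤ p := by positivity
  have hp1 : p ≤ 1 := (div_le_one hn0).2 hn
  have hx0 : 0 ≤ 1 - p := by linarith
  have hx1 : 1 - p ≤ 1 := by linarith
  have hyp : ∀ k : ℕ, ε * n < k → y ≤ k * p := by
    intro k hk
    have : ε * n * p ≤ k * p := mul_le_mul_of_nonneg_right hk.le hp0
    have e : ε * n * p = y := by rw [hp, hy]; field_simp
    linarith
  have hpow : ∀ k : ℕ, ε * n < k → δ ≤ 1 - (1 - p) ^ k := by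
    intro k hk
    have := (pow_le_exp_neg hp1 k).trans (Real.exp_le_exp.2 (neg_le_neg (hyp k hk)))
    linarith
  have hκa : (1 - p) ^ a * (1 + a * p) ≤ 1 - κ := by
    have hya := hyp a ha
    have h1 : (1 - p) ^ a * (1 + a * p) ≤ Real.exp (-(a * p)) * (1 + a * p) :=
      mul_le_mul_of_nonneg_right (pow_le_exp_neg hp1 a) (by positivity)
    have h2 : 1 + a * p ≤ Real.exp (a * p - y) * (1 + y) := by
      have := mul_le_mul_of_nonneg_right (Real.add_one_le_exp (a * p - y))
        (by linarith : 0 ≤ 1 + y)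
      nlinarith [mul_nonneg hy0.le (sub_nonneg.2 hya)]
    have h3 := mul_le_mul_of_nonneg_left h2 (Real.exp_pos (-(a * p))).le
    rw [← mul_assoc, ← Real.exp_add] at h3
    have e : -(a * p) + (a * p - y) = -y := by ring
    rw [e] at h3
    linarith
  have ha0 : (0 : ℝ) < a := lt_trans (by positivity) ha
  have hb0 : (0 : ℝ) < b := lt_trans (by positivity) hb
  have haN : 0 < a := by exact_mod_cast ha0
  have hbN : 0 < b := by exact_mod_cast hb0
  have habn : (a : ℝ) + b ≤ n := by exact_mod_cast hab
  set A := 1 - (1 - p) ^ a with hA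
  set B := 1 - (1 - p) ^ b with hB
  set M := 1 - (1 - p) ^ (a + b) with hM
  have hAδ : δ ≤ A := hpow a ha
  have hBδ : δ ≤ B := hpow b hb
  have hMpos : 0 < M := by
    have : δ ≤ M := hpow (a + b) (by push_cast; linarith)
    linarith
  have hgap := gap_le hp1 hκ0.le (by linarith) hMpos hκa
  have hεb : ε * κ ≤ b / (a + b) * κ := by
    refine mul_le_mul_of_nonneg_right ?_ hκ0.le
    rw [le_div_iff₀ (by linarith)]
    nlinarith
  have hMA : M = A + (1 - p) ^ a * B := by
    rw [hM, hA, hB, pow_add]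
    ring
  -- With `s = A / M`, the quantity to bound is `M ^ (a + b)` times a binomial probability.
  have hs1 : 1 - A / M = (1 - p) ^ a * B / M := by
    rw [eq_div_iff hMpos.ne', sub_mul, div_mul_cancel₀ _ hMpos.ne']
    linarith
  have hAM : A / M ≤ 1 := by
    have : 0 ≤ (1 - p) ^ a * B / M := by
      have := hδ0.le.trans hBδ
      positivity
    linarith
  have hch := choose_mul_pow_le_exp (s := A / M) (a := a) (m := a + b)
    (div_nonneg (hδ0.le.trans hAδ) hMpos.le) hAM (by omega) (by omega)
    (h := ε * κ) (by positivity) (by push_cast; linarith)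
  rw [Nat.add_sub_cancel_left, hs1, div_pow, div_pow, mul_pow, ← pow_mul] at hch
  have hexp : Real.exp (-(((a + b : ℕ) : ℝ) * (ε * κ) ^ 2 / 2)) ≤
      Real.exp (-(ε * (ε * κ) ^ 2 / 2 * n)) := by
    rw [Real.exp_le_exp]
    push_cast
    nlinarith [sq_nonneg (ε * κ)]
  have hA0 : 0 < A := hδ0.trans_le hAδ
  have hB0 : 0 < B := hδ0.trans_le hBδ
  have hmain : ((a + b).choose a : ℝ) * (A ^ a * B ^ b * (1 - p) ^ (a * b)) ≤
      Real.exp (-(ε * (ε * κ) ^ 2 / 2 * n)) * M ^ (a + b) := by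
    have h := mul_le_mul_of_nonneg_right (hch.trans hexp) (pow_pos hMpos (a + b)).le
    refine le_trans (le_of_eq ?_) h
    rw [pow_add]
    field_simp
  have hM1 : M ≤ 1 := by
    have := pow_nonneg hx0 (a + b)
    linarith
  have hL0 : 0 ≤ ((a + b).choose a : ℝ) *
      (A ^ (a - 1) * B ^ (b - 1) * (1 - p) ^ (a * b)) := by positivity
  rw [mul_assoc (1 / δ ^ 2), one_div_mul_eq_div, le_div_iff₀ (by positivity)]
  calc _ ≤ ((a + b).choose a : ℝ) * (A ^ (a - 1) * B ^ (b - 1) * (1 - p) ^ (a * b)) *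
        (A * B) := by
        refine mul_le_mul_of_nonneg_left ?_ hL0
        rw [sq]
        exact mul_le_mul hAδ hBδ hδ0.le hA0.le
    _ = ((a + b).choose a : ℝ) * (A ^ a * B ^ b * (1 - p) ^ (a * b)) := by
        conv_rhs => rw [← Nat.sub_add_cancel haN, ← Nat.sub_add_cancel hbN, pow_succ A, pow_succ B]
        simp only [Nat.sub_add_cancel (show 1 ≤ a from haN),
          Nat.sub_add_cancel (show 1 ≤ b from hbN)]
        ring
    _ ≤ _ := hmain
    _ ≤ _ := by
        refine mul_le_mul_of_nonneg_left ?_ (Real.exp_pos _).le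
        exact pow_le_pow_of_le_one hMpos.le hM1 (Nat.sub_le _ _)

/-- Two macroscopic connected pieces are exponentially less likely than a single connected one,
even after summing over all the ways of splitting the vertex set. -/
theorem exists_split_bound {lam ε : ℝ} (hlam : 0 < lam) (hε : 0 < ε) :
    ∃ D c : ℝ, 0 < D ∧ 0 < c ∧ ∀ {V : Type*} [Fintype V] (n : ℕ) (U : Finset V) (u : V),
      lam ≤ n → U.card ≤ n → u ∈ U →
      ∑ A ∈ U.powerset with u ∈ A ∧ ε * n < A.card ∧ ε * n < (U \ A).card,
        connProb (lam / n) A * connProb (lam / n) (U \ A) *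
          (1 - lam / n) ^ (A.card * (U \ A).card) ≤
        D * Real.exp (-(c * n)) * connProb (lam / n) U := by
  obtain ⟨D, c, hD, hc, h⟩ := exists_pair_bound hlam hε
  refine ⟨D * (16 / c ^ 2), c / 2, by positivity, by positivity, ?_⟩
  intro V _ n U u hn hUn hu
  have hn0 : (0 : ℝ) < n := hlam.trans_le hn
  have hp0 : 0 ≤ lam / n := by positivity
  have hp1 : lam / n ≤ 1 := (div_le_one hn0).2 hn
  set p := lam / n with hp
  have hx0 : 0 ≤ 1 - p := by linarith
  have hpk : ∀ k : ℕ, 0 ≤ 1 - (1 - p) ^ k := fun k => by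
    have := pow_le_one₀ (n := k) hx0 (by linarith)
    linarith
  set m := U.card with hm
  have hm0 : 0 < m := Finset.card_pos.2 ⟨u, hu⟩
  let F : ℕ → ℝ := fun a => if ε * n < a ∧ ε * n < (m - a : ℕ) then
    (1 - (1 - p) ^ a) ^ (a - 1) * (1 - (1 - p) ^ (m - a)) ^ (m - a - 1) *
      (1 - p) ^ (a * (m - a)) else 0
  have hF0 : ∀ a, 0 ≤ F a := by
    intro a
    dsimp only [F]
    split_ifs
    · have := hpk a
      have := hpk (m - a)
      positivity
    · rfl
  have hεn : 0 < ε * n := by positivity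
  -- After bounding the connection probabilities, the summand depends on the size of `A` only.
  have step1 : ∑ A ∈ U.powerset with u ∈ A ∧ ε * n < A.card ∧ ε * n < (U \ A).card,
        connProb p A * connProb p (U \ A) * (1 - p) ^ (A.card * (U \ A).card) ≤
      ∑ A ∈ U.powerset, F A.card := by
    refine le_trans (Finset.sum_le_sum fun A hA => ?_)
      (Finset.sum_le_sum_of_subset_of_nonneg (Finset.filter_subset _ _) fun A _ _ => hF0 _)
    obtain ⟨hAU, -, hA1, hA2⟩ := Finset.mem_filter.1 hA
    rw [Finset.mem_powerset] at hAU
    have hAne : A.Nonempty := Finset.card_pos.1 (by exact_mod_cast hεn.trans hA1)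
    have hBne : (U \ A).Nonempty := Finset.card_pos.1 (by exact_mod_cast hεn.trans hA2)
    have e := Finset.card_sdiff_of_subset hAU
    have hB := connProb_le hp0 hp1 hBne
    rw [e] at hB hA2 ⊢
    dsimp only [F]
    rw [if_pos ⟨hA1, hA2⟩]
    refine mul_le_mul_of_nonneg_right ?_ (by positivity)
    exact mul_le_mul (connProb_le hp0 hp1 hAne) hB (connProb_nonneg hp0 hp1 _)
      (pow_nonneg (hpk _) _)
  have step2 : ∑ A ∈ U.powerset, F A.card ≤
      (m + 1) * (D * Real.exp (-(c * n)) * (1 - (1 - p) ^ m) ^ (m - 1)) := by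
    rw [Finset.sum_powerset_apply_card]
    refine le_trans (Finset.sum_le_card_nsmul _ _
      (D * Real.exp (-(c * n)) * (1 - (1 - p) ^ m) ^ (m - 1)) ?_) (by simp [← hm])
    intro a ha
    have ham : a ≤ m := Nat.lt_succ_iff.1 (Finset.mem_range.1 ha)
    have hR : 0 ≤ D * Real.exp (-(c * n)) * (1 - (1 - p) ^ m) ^ (m - 1) := by
      have := hpk m
      positivity
    rw [nsmul_eq_mul]
    dsimp only [F]
    split_ifs with hcase
    · have := h n a (m - a) hn hcase.1 hcase.2 (by omega)
      rwa [Nat.add_sub_cancel' ham] at this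
    · simpa using hR
  have step3 : (1 - (1 - p) ^ m) ^ (m - 1) ≤ m * connProb p U := by
    have := le_connProb hp0 hp1 (A := U) ⟨u, hu⟩
    rw [← hm, one_div, inv_mul_le_iff₀ (by positivity)] at this
    exact this
  have hmn : (m : ℝ) ≤ n := by exact_mod_cast hUn
  have hn1 : (1 : ℝ) ≤ n := by exact_mod_cast (by exact_mod_cast hn0 : 0 < n)
  -- Half of the exponential rate absorbs the polynomial factor.
  have hmm : ((m : ℝ) + 1) * m ≤ 16 / c ^ 2 * Real.exp (c / 2 * n) := by
    have hq := Real.quadratic_le_exp_of_nonneg (x := c / 2 * n) (by positivity)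
    have : (c / 2 * n) ^ 2 / 2 ≤ Real.exp (c / 2 * n) := by
      have : 0 ≤ c / 2 * n := by positivity
      linarith
    have h2 : 16 / c ^ 2 * ((c / 2 * n) ^ 2 / 2) = 2 * n ^ 2 := by
      field_simp
      ring
    have h3 := mul_le_mul_of_nonneg_left this (by positivity : 0 ≤ 16 / c ^ 2)
    nlinarith [(Nat.cast_nonneg m : (0 : ℝ) ≤ m)]
  have hC0 := connProb_nonneg hp0 hp1 U
  calc _ ≤ _ := step1
    _ ≤ _ := step2
    _ ≤ (m + 1) * (D * Real.exp (-(c * n)) * (m * connProb p U)) := by gcongr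
    _ = ((m + 1) * m) * (D * Real.exp (-(c * n)) * connProb p U) := by ring
    _ ≤ 16 / c ^ 2 * Real.exp (c / 2 * n) * (D * Real.exp (-(c * n)) * connProb p U) := by
        gcongr
    _ = _ := by
        have : Real.exp (-(c / 2 * n)) = Real.exp (c / 2 * n) * Real.exp (-(c * n)) := by
          rw [← Real.exp_add]
          ring_nf
        rw [this]
        ring

end

/-! ### Large components merge -/

section
open scoped Classical

variable {V : Type*}

/-- The weight of a component `A` when the vertices in components with more than `r` vertices are
required to form the set `U`: either `A` is large and inside `U`, or small and outside `U`. -/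
noncomputable def splitWeight (q r : ℝ) (U A : Finset V) : ℝ :=
  if (A ⊆ U ∧ r < A.card) ∨ (Disjoint A U ∧ (A.card : ℝ) ≤ r) then q else 0

theorem splitWeight_nonneg {q : ℝ} (hq : 0 ≤ q) (r : ℝ) (U A : Finset V) :
    0 ≤ splitWeight q r U A := by
  unfold splitWeight
  split_ifs
  exacts [hq, le_rfl]

theorem splitWeight_of_subset {q r : ℝ} {U A : Finset V} (hA : A ⊆ U) (hr : r < A.card) :
    splitWeight q r U A = q := if_pos (Or.inl ⟨hA, hr⟩)

theorem splitWeight_eq_zero {q r : ℝ} {U A : Finset V} {u : V} (hu : u ∈ A) (huU : u ∈ U)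
    (h : A ⊆ U → (A.card : ℝ) ≤ r) : splitWeight q r U A = 0 := by
  refine if_neg ?_
  rintro (⟨h1, h2⟩ | ⟨h1, -⟩)
  · exact absurd (h h1) (not_le.2 h2)
  · exact Finset.disjoint_left.1 h1 hu huU

variable [Fintype V]

/-- The contribution to `clusterSum p (splitWeight q r U) T` of the configurations in which
`T ∩ U` is a single component, provided it has more than `r` vertices. -/
noncomputable def mergedWeight (p q r : ℝ) (U T : Finset V) : ℝ :=
  q * (connProb p (T ∩ U) * (1 - p) ^ ((T ∩ U).card * (T \ U).card) *
    clusterSum p (splitWeight q r U) (T \ U))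

theorem mergedWeight_nonneg {p q : ℝ} (h0 : 0 ≤ p) (h1 : p ≤ 1) (hq : 0 ≤ q) (r : ℝ)
    (U T : Finset V) : 0 ≤ mergedWeight p q r U T := by
  have hx : 0 ≤ 1 - p := by linarith
  have := connProb_nonneg h0 h1 (T ∩ U)
  have := clusterSum_nonneg h0 h1 (splitWeight_nonneg hq r U) (T \ U)
  unfold mergedWeight
  positivity

omit [Fintype V] in
theorem card_sdiff_inter (T U : Finset V) : T.card - (T ∩ U).card = (T \ U).card := by
  rw [Finset.card_sdiff, Finset.inter_comm]

/-- A nonempty set of at most `r` vertices is not a union of components with more than `r`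
vertices. -/
theorem clusterSum_splitWeight_eq_zero (p q : ℝ) {r : ℝ} {U T : Finset V}
    (hTU : (T ∩ U).Nonempty) (hr : ((T ∩ U).card : ℝ) ≤ r) :
    clusterSum p (splitWeight q r U) T = 0 := by
  obtain ⟨u, hu⟩ := hTU
  rw [Finset.mem_inter] at hu
  rw [clusterSum_eq_sum p _ hu.1]
  refine Finset.sum_eq_zero fun A hA => ?_
  rw [Finset.mem_filter, Finset.mem_powerset] at hA
  rw [splitWeight_eq_zero hA.2 hu.2 fun hAU => ?_, zero_mul]
  refine le_trans ?_ hr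
  exact_mod_cast Finset.card_le_card (Finset.subset_inter hA.1 hAU)

/-- The contribution of the configurations in which the component `A` of `u` is not the whole of
`T ∩ U`. Replacing the rest `(T ∩ U) \ A` by a single component costs the factor `K`, and merging it
with `A` then gains the factor `τ`. -/
theorem sum_split_le {p q r K τ : ℝ} (h0 : 0 ≤ p) (h1 : p ≤ 1) (hq : 0 ≤ q) (hr : 0 ≤ r)
    (hK : 0 ≤ K) {U T : Finset V} {u : V} (hu : u ∈ T ∩ U)
    (hτ : ∑ A ∈ (T ∩ U).powerset with u ∈ A ∧ r < A.card ∧ r < ((T ∩ U) \ A).card,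
        connProb p A * connProb p ((T ∩ U) \ A) * (1 - p) ^ (A.card * ((T ∩ U) \ A).card) ≤
      τ * connProb p (T ∩ U))
    (hZ : ∀ A ⊆ T ∩ U, r < A.card → r < ((T ∩ U) \ A).card →
      clusterSum p (splitWeight q r U) (T \ A) ≤ K * mergedWeight p q r U (T \ A)) :
    ∑ A ∈ T.powerset with u ∈ A ∧ A ≠ T ∩ U, splitWeight q r U A *
        (connProb p A * (1 - p) ^ (A.card * (T.card - A.card)) *
          clusterSum p (splitWeight q r U) (T \ A)) ≤
      K * q * τ * mergedWeight p q r U T := by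
  have hx : 0 ≤ 1 - p := by linarith
  have huT := (Finset.mem_inter.1 hu).1
  have huU := (Finset.mem_inter.1 hu).2
  have hZ0 := clusterSum_nonneg h0 h1 (splitWeight_nonneg hq r U) (T \ U)
  rw [← Finset.sum_subset (s₁ := (T ∩ U).powerset.filter
    fun A => u ∈ A ∧ r < A.card ∧ r < ((T ∩ U) \ A).card)]
  · calc _ ≤ ∑ A ∈ (T ∩ U).powerset with u ∈ A ∧ r < A.card ∧ r < ((T ∩ U) \ A).card,
          K * q * q * (1 - p) ^ ((T ∩ U).card * (T \ U).card) *
            clusterSum p (splitWeight q r U) (T \ U) *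
            (connProb p A * connProb p ((T ∩ U) \ A) *
              (1 - p) ^ (A.card * ((T ∩ U) \ A).card)) := by
          refine Finset.sum_le_sum fun A hA => ?_
          obtain ⟨hAT, huA, hA1, hA2⟩ := Finset.mem_filter.1 hA
          rw [Finset.mem_powerset] at hAT
          have hAU : A ⊆ U := hAT.trans Finset.inter_subset_right
          have hAT' : A ⊆ T := hAT.trans Finset.inter_subset_left
          rw [splitWeight_of_subset hAU hA1]
          have hZA := hZ A hAT hA1 hA2
          have e1 : (T \ A) ∩ U = (T ∩ U) \ A := by
            ext v
            simp only [Finset.mem_inter, Finset.mem_sdiff]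
            tauto
          have e2 : (T \ A) \ U = T \ U := by
            ext v
            simp only [Finset.mem_sdiff]
            have := @hAU v
            tauto
          rw [mergedWeight, e1, e2] at hZA
          have hc := Finset.card_sdiff_add_card_eq_card hAT
          have hT := Finset.card_sdiff_add_card_inter T U
          have hexp : A.card * (T.card - A.card) + ((T ∩ U) \ A).card * (T \ U).card =
              (T ∩ U).card * (T \ U).card + A.card * ((T ∩ U) \ A).card := by
            have : T.card - A.card = (T \ U).card + ((T ∩ U) \ A).card := by omega
            rw [this, ← hc]
            ring
          have hC := connProb_nonneg h0 h1 A
          calc _ ≤ q * (connProb p A * (1 - p) ^ (A.card * (T.card - A.card)) *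
                (K * (q * (connProb p ((T ∩ U) \ A) *
                  (1 - p) ^ (((T ∩ U) \ A).card * (T \ U).card) *
                  clusterSum p (splitWeight q r U) (T \ U))))) := by gcongr
            _ = K * q * q * connProb p A * connProb p ((T ∩ U) \ A) *
                clusterSum p (splitWeight q r U) (T \ U) *
                (1 - p) ^ (A.card * (T.card - A.card) +
                  ((T ∩ U) \ A).card * (T \ U).card) := by rw [pow_add]; ring
            _ = _ := by rw [hexp, pow_add]; ring
      _ ≤ K * q * q * (1 - p) ^ ((T ∩ U).card * (T \ U).card) *
            clusterSum p (splitWeight q r U) (T \ U) * (τ * connProb p (T ∩ U)) := by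
          rw [← Finset.mul_sum]
          exact mul_le_mul_of_nonneg_left hτ (by positivity)
      _ = _ := by
          rw [mergedWeight]
          ring
  · intro A hA
    obtain ⟨hAT, huA, hA1, hA2⟩ := Finset.mem_filter.1 hA
    rw [Finset.mem_powerset] at hAT
    refine Finset.mem_filter.2
      ⟨Finset.mem_powerset.2 (hAT.trans Finset.inter_subset_left), huA, ?_⟩
    rintro rfl
    simp only [Finset.sdiff_self, Finset.card_empty, Nat.cast_zero] at hA2
    linarith
  · intro A hA hA'
    obtain ⟨hAT, huA, hne⟩ := Finset.mem_filter.1 hA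
    rw [Finset.mem_powerset] at hAT
    by_cases hs : A ⊆ U ∧ r < A.card
    · have hsub : A ⊆ T ∩ U := Finset.subset_inter hAT hs.1
      have e1 : (T \ A) ∩ U = (T ∩ U) \ A := by
        ext v
        simp only [Finset.mem_inter, Finset.mem_sdiff]
        tauto
      rw [clusterSum_splitWeight_eq_zero p q (U := U) (T := T \ A), mul_zero, mul_zero]
      · rw [e1, Finset.sdiff_nonempty]
        exact fun h => hne (hsub.antisymm h)
      · rw [e1]
        by_contra hlt
        exact hA' (Finset.mem_filter.2
          ⟨Finset.mem_powerset.2 hsub, huA, hs.2, not_le.1 hlt⟩)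
    · rw [splitWeight_eq_zero huA huU, zero_mul]
      exact fun h => not_lt.1 fun h' => hs ⟨h, h'⟩

/-- The term `A = T ∩ U` of the decomposition according to the component of `u`, set apart. -/
theorem clusterSum_eq_mergedWeight_add (p q : ℝ) {r : ℝ} {U T : Finset V} {u : V}
    (hu : u ∈ T ∩ U) (hr : r < (T ∩ U).card) :
    clusterSum p (splitWeight q r U) T = mergedWeight p q r U T +
      ∑ A ∈ T.powerset with u ∈ A ∧ A ≠ T ∩ U, splitWeight q r U A *
        (connProb p A * (1 - p) ^ (A.card * (T.card - A.card)) *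
          clusterSum p (splitWeight q r U) (T \ A)) := by
  have hmem : T ∩ U ∈ T.powerset.filter fun A => u ∈ A :=
    Finset.mem_filter.2 ⟨Finset.mem_powerset.2 Finset.inter_subset_left, hu⟩
  rw [clusterSum_eq_sum p _ (Finset.mem_inter.1 hu).1, ← Finset.add_sum_erase _ _ hmem,
    splitWeight_of_subset Finset.inter_subset_right hr, card_sdiff_inter,
    Finset.sdiff_inter_self_left]
  congr 1
  refine Finset.sum_congr ?_ fun _ _ => rfl
  ext A
  simp only [Finset.mem_erase, Finset.mem_filter]
  tauto

/-- Since every large component uses more than `r` vertices, splitting off large components one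
after another terminates after a bounded number of steps, at a bounded total cost. -/
theorem clusterSum_le_geom_mul {p q r D : ℝ} (h0 : 0 ≤ p) (h1 : p ≤ 1) (hq : 0 ≤ q)
    (hr : 0 ≤ r) (hD : 0 ≤ D)
    (hsplit : ∀ (W : Finset V) (u : V), u ∈ W →
      ∑ A ∈ W.powerset with u ∈ A ∧ r < A.card ∧ r < (W \ A).card,
        connProb p A * connProb p (W \ A) * (1 - p) ^ (A.card * (W \ A).card) ≤
      D * connProb p W) (U : Finset V) (j : ℕ) :
    ∀ T : Finset V, (T ∩ U).Nonempty → ((T ∩ U).card : ℝ) ≤ j * r →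
      clusterSum p (splitWeight q r U) T ≤
        (∑ i ∈ Finset.range j, (q * D) ^ i) * mergedWeight p q r U T := by
  induction j with
  | zero =>
    intro T hT hcard
    have := Finset.card_pos.2 hT
    have : (0 : ℝ) < (T ∩ U).card := by exact_mod_cast this
    simp only [Nat.cast_zero, zero_mul] at hcard
    linarith
  | succ j ih =>
    intro T hT hcard
    obtain ⟨u, hu⟩ := hT
    rcases le_or_gt ((T ∩ U).card : ℝ) r with hle | hlt
    · rw [clusterSum_splitWeight_eq_zero p q ⟨u, hu⟩ hle]
      have := mergedWeight_nonneg h0 h1 hq r U T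
      positivity
    · rw [clusterSum_eq_mergedWeight_add p q hu hlt, geom_sum_succ]
      have := sum_split_le (K := ∑ i ∈ Finset.range j, (q * D) ^ i) h0 h1 hq hr
        (by positivity) hu (hsplit _ u hu) fun A hA hA1 hA2 => ?_
      · linarith
      · have e1 : (T \ A) ∩ U = (T ∩ U) \ A := by
          ext v
          simp only [Finset.mem_inter, Finset.mem_sdiff]
          tauto
        refine ih (T \ A) ?_ ?_
        · rw [e1]
          exact Finset.card_pos.1 (by exact_mod_cast hr.trans_lt hA2)
        · rw [e1]
          have hc := Finset.card_sdiff_add_card_eq_card hA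
          have hc' : (((T ∩ U) \ A).card : ℝ) + A.card = (T ∩ U).card := by exact_mod_cast hc
          push_cast at hcard
          linarith

/-- An excess factor `1 + T * exp (-s)` is absorbed by a smaller exponential rate, uniformly in
`s`. -/
theorem exp_scaled_bound {T s : ℝ} (hT : 1 ≤ T) :
    (1 - Real.exp (-(s / T))) * (1 + T * Real.exp (-s)) ≤ 1 := by
  have hT0 : 0 < T := by linarith
  -- convexity of `exp` between `0` and `s`
  have hconv : Real.exp (s / T) ≤ 1 + Real.exp s / T := by
    have h := convexOn_exp.2 (Set.mem_univ 0) (Set.mem_univ s)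
      (sub_nonneg.2 (inv_le_one_of_one_le₀ hT)) (inv_nonneg.2 hT0.le) (by ring)
    simp only [smul_eq_mul, mul_zero, zero_add, Real.exp_zero, mul_one] at h
    rw [inv_mul_eq_div, inv_mul_eq_div] at h
    have : 0 < T⁻¹ := inv_pos.2 hT0
    linarith
  have h1 : Real.exp (-(s / T)) * Real.exp (s / T) = 1 := by
    rw [← Real.exp_add, neg_add_cancel, Real.exp_zero]
  have h2 : T * Real.exp (-s) * (Real.exp s / T) = 1 := by
    rw [mul_div_assoc', mul_assoc, ← Real.exp_add, neg_add_cancel, Real.exp_zero, mul_one,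
      div_self hT0.ne']
  have hE := Real.exp_pos (-(s / T))
  have hF : 0 < T * Real.exp (-s) := by
    have := Real.exp_pos (-s)
    positivity
  have h3 := mul_le_mul_of_nonneg_left hconv (mul_pos hE hF).le
  nlinarith [h3, h1, h2]

/-- Given that the vertices in large components form the set `U`, it is exponentially unlikely
that `U` is not a single component. -/
theorem exists_mergedWeight_bound {q lam ε : ℝ} (hq : 0 < q) (hlam : 0 < lam) (hε : 0 < ε) :
    ∃ c : ℝ, 0 < c ∧ ∀ {V : Type*} [Fintype V], lam ≤ (Fintype.card V : ℝ) →
      ∀ U : Finset V, U.Nonempty → ε * Fintype.card V < U.card →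
      (1 - Real.exp (-c * Fintype.card V)) *
        clusterSum (lam / Fintype.card V) (splitWeight q (ε * Fintype.card V) U) Finset.univ ≤
      mergedWeight (lam / Fintype.card V) q (ε * Fintype.card V) U Finset.univ := by
  obtain ⟨D, c, hD, hc, h⟩ := exists_split_bound hlam hε
  -- There are fewer than `1 / ε` components with more than `ε * n` vertices.
  obtain ⟨j, hj⟩ := exists_nat_ge (1 / ε)
  set K := ∑ i ∈ Finset.range j, (q * D) ^ i with hK
  have hK0 : 0 ≤ K := by positivity
  have hT1 : 1 ≤ 1 + K * q * D := by
    have : 0 ≤ K * q * D := by positivity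
    linarith
  refine ⟨c / (1 + K * q * D), by positivity, ?_⟩
  intro V _ hn U hU hUr
  set n := Fintype.card V
  have hn0 : (0 : ℝ) < n := hlam.trans_le hn
  have hp0 : 0 ≤ lam / n := by positivity
  have hp1 : lam / n ≤ 1 := (div_le_one hn0).2 hn
  have hr : 0 ≤ ε * n := by positivity
  obtain ⟨u, hu⟩ := hU
  have hu' : u ∈ Finset.univ ∩ U := by simpa using hu
  have hUr' : ε * n < (Finset.univ ∩ U : Finset V).card := by rwa [Finset.univ_inter]
  have hexp1 : Real.exp (-(c * n)) ≤ 1 := Real.exp_le_one_iff.2 (by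
    have : 0 ≤ c * n := by positivity
    linarith)
  have hgeom := clusterSum_le_geom_mul hp0 hp1 hq.le hr hD.le (fun W v hv => by
    refine (h n W v hn (Finset.card_le_univ W) hv).trans ?_
    refine mul_le_mul_of_nonneg_right ?_ (connProb_nonneg hp0 hp1 W)
    exact mul_le_of_le_one_right hD.le hexp1) U j
  have hjn : (n : ℝ) ≤ j * (ε * n) := by
    rw [div_le_iff₀ hε] at hj
    nlinarith
  have hsum := sum_split_le (K := K) hp0 hp1 hq.le hr hK0 hu'
    (h n _ u hn (Finset.card_le_univ _) hu') (fun A hA hA1 hA2 => by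
      have e1 : (Finset.univ \ A) ∩ U = (Finset.univ ∩ U) \ A := by
        ext v
        simp only [Finset.mem_inter, Finset.mem_sdiff]
        tauto
      refine hgeom (Finset.univ \ A) ?_ (le_trans ?_ hjn)
      · rw [e1]
        exact Finset.card_pos.1 (by exact_mod_cast hr.trans_lt hA2)
      · exact_mod_cast Finset.card_le_univ _)
  rw [clusterSum_eq_mergedWeight_add _ q hu' hUr']
  set M := mergedWeight (lam / n) q (ε * n) U Finset.univ
  have hM : 0 ≤ M := mergedWeight_nonneg hp0 hp1 hq.le _ _ _
  have hbound := exp_scaled_bound (T := 1 + K * q * D) (s := c * n) hT1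
  have hE := Real.exp_pos (-(c * n))
  have e : -(c / (1 + K * q * D)) * n = -(c * n / (1 + K * q * D)) := by ring
  rw [e]
  have hle1 : 0 ≤ 1 - Real.exp (-(c * n / (1 + K * q * D))) := by
    have : Real.exp (-(c * n / (1 + K * q * D))) ≤ 1 := Real.exp_le_one_iff.2 (by
      have : 0 ≤ c * n / (1 + K * q * D) := by positivity
      linarith)
    linarith
  calc _ ≤ (1 - Real.exp (-(c * n / (1 + K * q * D)))) *
        ((1 + (1 + K * q * D) * Real.exp (-(c * n))) * M) := by
        refine mul_le_mul_of_nonneg_left ?_ hle1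
        have : 0 ≤ Real.exp (-(c * n)) * M := by positivity
        nlinarith
    _ ≤ 1 * M := by
        rw [← mul_assoc]
        exact mul_le_mul_of_nonneg_right hbound hM
    _ = M := one_mul M

end

/-! ### Translation to the random cluster measure -/

section
open scoped Classical

variable {V : Type*} [Fintype V]

theorem mem_cluster_univ {G : SimpleGraph V} {u v : V} :
    v ∈ cluster G Finset.univ u ↔ G.Reachable u v := by
  rw [mem_cluster, within_univ]
  simp

theorem coe_cluster_univ (G : SimpleGraph V) (v : V) :
    (cluster G Finset.univ v : Set V) = (G.connectedComponentMk v).supp := by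
  ext w
  rw [Finset.mem_coe, mem_cluster_univ, SimpleGraph.ConnectedComponent.mem_supp_iff,
    SimpleGraph.ConnectedComponent.eq]
  exact ⟨fun h => h.symm, fun h => h.symm⟩

theorem ncard_supp_connectedComponentMk (G : SimpleGraph V) (v : V) :
    (G.connectedComponentMk v).supp.ncard = (cluster G Finset.univ v).card := by
  rw [← coe_cluster_univ, Set.ncard_coe_finset]

theorem card_clusters_univ (ω : Config (⊤ : SimpleGraph V)) :
    (clusters (openGraph ω) Finset.univ).card = numComponents ω := by
  have : clusters (openGraph ω) Finset.univ =
      (Finset.univ : Finset (openGraph ω).ConnectedComponent).image fun C => C.supp.toFinset := by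
    ext A
    simp only [clusters, Finset.mem_image, Finset.mem_univ, true_and]
    constructor
    · rintro ⟨v, rfl⟩
      refine ⟨(openGraph ω).connectedComponentMk v, ?_⟩
      rw [← Finset.coe_inj, coe_cluster_univ, Set.coe_toFinset]
    · rintro ⟨C, rfl⟩
      induction C using SimpleGraph.ConnectedComponent.ind with
      | _ v =>
        refine ⟨v, ?_⟩
        rw [← Finset.coe_inj, coe_cluster_univ, Set.coe_toFinset]
  rw [this, Finset.card_image_of_injective, numComponents, Nat.card_eq_fintype_card,
    Finset.card_univ]
  intro C C' h
  exact SimpleGraph.ConnectedComponent.supp_injective (Set.toFinset_inj.1 h)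

theorem mem_largeVertices {r : ℝ} {ω : Config (⊤ : SimpleGraph V)} {v : V} :
    v ∈ largeVertices r ω ↔ r < (cluster (openGraph ω) Finset.univ v).card := by
  rw [largeVertices, Set.mem_ofPred_eq, ncard_supp_connectedComponentMk]

/-- The product of `splitWeight` over the components encodes both the weight `q ^ k(ω)` and the
event that `U` is the set of vertices in large components. -/
theorem prod_splitWeight (q r : ℝ) (U : Finset V) (ω : Config (⊤ : SimpleGraph V)) :
    ∏ C ∈ clusters (openGraph ω) Finset.univ, splitWeight q r U C =
      if largeVertices r ω = U then q ^ numComponents ω else 0 := by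
  unfold splitWeight
  have hiff : (∀ C ∈ clusters (openGraph ω) Finset.univ,
      (C ⊆ U ∧ r < C.card) ∨ (Disjoint C U ∧ (C.card : ℝ) ≤ r)) ↔ largeVertices r ω = U := ?_
  · by_cases h : largeVertices r ω = U
    · rw [if_pos h, Finset.prod_congr rfl fun C hC => if_pos (hiff.2 h C hC), Finset.prod_const,
        card_clusters_univ]
    · rw [if_neg h]
      have hn := mt hiff.1 h
      push Not at hn
      obtain ⟨C, hC, h1, h2⟩ := hn
      refine Finset.prod_eq_zero hC (if_neg ?_)
      rintro (⟨h3, h4⟩ | ⟨h3, h4⟩)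
      exacts [absurd h4 (not_lt.2 (h1 h3)), absurd h4 (not_le.2 (h2 h3))]
  constructor
  · intro h
    ext v
    rw [mem_largeVertices, Finset.mem_coe]
    have hv := self_mem_cluster (openGraph ω) (Finset.mem_univ v)
    rcases h _ (Finset.mem_image_of_mem _ (Finset.mem_univ v)) with h | h
    · exact ⟨fun _ => h.1 hv, fun _ => h.2⟩
    · exact ⟨fun h' => absurd h' (not_lt.2 h.2),
        fun h' => absurd h' (Finset.disjoint_left.1 h.1 hv)⟩
  · intro h C hC
    obtain ⟨v, -, rfl⟩ := Finset.mem_image.1 hC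
    have hmem : ∀ w ∈ cluster (openGraph ω) Finset.univ v,
        w ∈ U ↔ r < (cluster (openGraph ω) Finset.univ v).card := by
      intro w hw
      rw [← Finset.mem_coe, ← h, mem_largeVertices, cluster_eq_of_mem hw]
    rcases lt_or_ge r (cluster (openGraph ω) Finset.univ v).card with hlt | hge
    · exact Or.inl ⟨fun w hw => (hmem w hw).2 hlt, hlt⟩
    · exact Or.inr ⟨Finset.disjoint_left.2 fun w hw hwU =>
        absurd ((hmem w hw).1 hwU) (not_lt.2 hge), hge⟩

theorem unnormalised_eq_expect (p q : ℝ) (S : Set (Config (⊤ : SimpleGraph V))) :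
    unnormalised ⊤ p q S = expect p fun ω => if ω ∈ S then q ^ numComponents ω else 0 := by
  unfold unnormalised expect weight
  refine Finset.sum_congr (by congr!) fun ω _ => ?_
  rw [mul_ite, mul_zero]
  congr!

theorem unnormalised_mono {p q : ℝ} (h0 : 0 ≤ p) (h1 : p ≤ 1) (hq : 0 ≤ q)
    {S S' : Set (Config (⊤ : SimpleGraph V))} (h : S ⊆ S') :
    unnormalised ⊤ p q S ≤ unnormalised ⊤ p q S' := by
  rw [unnormalised_eq_expect, unnormalised_eq_expect]
  refine expect_mono h0 h1 fun ω => ?_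
  have := pow_nonneg hq (numComponents ω)
  split_ifs with a b
  exacts [le_rfl, absurd (h a) b, this, le_rfl]

theorem unnormalised_nonneg {p q : ℝ} (h0 : 0 ≤ p) (h1 : p ≤ 1) (hq : 0 ≤ q)
    (S : Set (Config (⊤ : SimpleGraph V))) : 0 ≤ unnormalised ⊤ p q S := by
  rw [unnormalised_eq_expect]
  refine expect_nonneg h0 h1 fun ω => ?_
  split_ifs
  exacts [pow_nonneg hq _, le_rfl]

theorem partitionFunction_pos {p q : ℝ} (h0 : 0 < p) (h1 : p ≤ 1) (hq : 0 < q) :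
    0 < partitionFunction (⊤ : SimpleGraph V) p q := by
  rw [partitionFunction, unnormalised_eq_expect]
  refine expect_pos h0 h1 (fun ω => ?_) ?_
  · rw [if_pos (Set.mem_univ ω)]
    exact pow_nonneg hq.le _
  · rw [if_pos (Set.mem_univ _)]
    exact pow_pos hq _

theorem unnormalised_eq_sum (p q r : ℝ) (S : Set (Config (⊤ : SimpleGraph V))) :
    unnormalised ⊤ p q S =
      ∑ U : Finset V, unnormalised ⊤ p q {ω | largeVertices r ω = U ∧ ω ∈ S} := by
  simp_rw [unnormalised_eq_expect]
  rw [← expect_sum]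
  congr 1
  funext ω
  rw [Finset.sum_eq_single (largeVertices r ω).toFinset]
  · simp
  · intro U _ hU
    refine if_neg fun h => hU ?_
    rw [← Finset.coe_inj, Set.coe_toFinset]
    exact h.1.symm
  · simp

theorem unnormalised_largeVertices_eq (p q r : ℝ) (U : Finset V) :
    unnormalised ⊤ p q {ω : Config (⊤ : SimpleGraph V) | largeVertices r ω = U} =
      clusterSum p (splitWeight q r U) Finset.univ := by
  rw [unnormalised_eq_expect, clusterSum]
  simp_rw [prod_splitWeight]
  rfl

theorem numLarge_eq_one {r : ℝ} {ω : Config (⊤ : SimpleGraph V)} {u : V}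
    (hu : u ∈ largeVertices r ω)
    (h : (cluster (openGraph ω) Finset.univ u : Set V) = largeVertices r ω) :
    numLarge r ω = 1 := by
  rw [numLarge, Set.ncard_eq_one]
  refine ⟨(openGraph ω).connectedComponentMk u, ?_⟩
  ext C
  rw [Set.mem_ofPred_eq, Set.mem_singleton_iff]
  constructor
  · induction C using SimpleGraph.ConnectedComponent.ind with
    | _ v =>
      intro hv
      have hv' : v ∈ largeVertices r ω := hv
      rw [← h, Finset.mem_coe, mem_cluster_univ] at hv'
      exact SimpleGraph.ConnectedComponent.sound hv'.symm
  · rintro rfl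
    exact hu

theorem numLarge_eq_zero {r : ℝ} {ω : Config (⊤ : SimpleGraph V)}
    (h : largeVertices r ω = ∅) : numLarge r ω = 0 := by
  rw [numLarge, Set.ncard_eq_zero, Set.eq_empty_iff_forall_notMem]
  intro C
  induction C using SimpleGraph.ConnectedComponent.ind with
  | _ v =>
    intro hv
    have hv' : v ∈ largeVertices r ω := hv
    simp [h] at hv'

/-- If `U` is a component and the set of vertices in large components, then it is the only large
component. -/
theorem mergedWeight_le_unnormalised {p q r : ℝ} (h0 : 0 ≤ p) (h1 : p ≤ 1) (hq : 0 ≤ q)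
    {U : Finset V} (hU : U.Nonempty) (hr : r < U.card) :
    mergedWeight p q r U Finset.univ ≤
      unnormalised ⊤ p q {ω : Config (⊤ : SimpleGraph V) |
        largeVertices r ω = U ∧ numLarge r ω = 1} := by
  obtain ⟨u, hu⟩ := hU
  have h := expect_cluster_eq p (splitWeight q r U) (Finset.subset_univ U) hu
  rw [splitWeight_of_subset (Finset.Subset.refl U) hr] at h
  have e : mergedWeight p q r U Finset.univ = q * (connProb p U *
      (1 - p) ^ (U.card * ((Finset.univ : Finset V).card - U.card)) *
      clusterSum p (splitWeight q r U) (Finset.univ \ U)) := by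
    rw [mergedWeight, Finset.univ_inter, Finset.card_sdiff_of_subset (Finset.subset_univ U)]
  rw [e, ← h, unnormalised_eq_expect]
  refine expect_mono h0 h1 fun ω => ?_
  rw [prod_splitWeight, Set.mem_ofPred_eq]
  have hpow := pow_nonneg hq (numComponents ω)
  by_cases hc : cluster (openGraph ω) Finset.univ u = U
  · by_cases hL : largeVertices r ω = U
    · have hN : numLarge r ω = 1 :=
        numLarge_eq_one (u := u) (by rw [hL]; exact hu) (by rw [hc, hL])
      simp [hc, hL, hN]
    · simp [hL]
  · rw [if_neg hc, zero_mul]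
    split_ifs
    exacts [hpow, le_rfl]

/-- An inequality that holds given each possible value of the set of large vertices holds given
any property of this set. -/
theorem mul_unnormalised_le {p q r s : ℝ} (P : Set V → Prop)
    (Q : Config (⊤ : SimpleGraph V) → Prop)
    (h : ∀ U : Finset V, P (U : Set V) →
      s * unnormalised ⊤ p q {ω : Config (⊤ : SimpleGraph V) | largeVertices r ω = U} ≤
      unnormalised ⊤ p q {ω | largeVertices r ω = U ∧ Q ω}) :
    s * unnormalised ⊤ p q {ω : Config (⊤ : SimpleGraph V) | P (largeVertices r ω)} ≤
      unnormalised ⊤ p q {ω | P (largeVertices r ω) ∧ Q ω} := by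
  rw [unnormalised_eq_sum p q r, unnormalised_eq_sum p q r {ω | P _ ∧ Q ω}, Finset.mul_sum]
  refine Finset.sum_le_sum fun U _ => ?_
  by_cases hP : P (U : Set V)
  · have e1 : {ω | largeVertices r ω = U ∧ ω ∈ {ω | P (largeVertices r ω)}} =
        {ω : Config (⊤ : SimpleGraph V) | largeVertices r ω = U} := by
      ext ω
      simp only [Set.mem_ofPred_eq, and_iff_left_iff_imp]
      exact fun h => h ▸ hP
    have e2 : {ω | largeVertices r ω = U ∧ ω ∈ {ω | P (largeVertices r ω) ∧ Q ω}} =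
        {ω : Config (⊤ : SimpleGraph V) | largeVertices r ω = U ∧ Q ω} := by
      ext ω
      simp only [Set.mem_ofPred_eq]
      exact and_congr_right fun h => and_iff_right (h ▸ hP)
    rw [e1, e2]
    exact h U hP
  · have e1 : ∀ Q' : Config (⊤ : SimpleGraph V) → Prop,
        {ω | largeVertices r ω = U ∧ P (largeVertices r ω) ∧ Q' ω} = ∅ := by
      intro Q'
      ext ω
      simp only [Set.mem_ofPred_eq, Set.mem_empty_iff_false, iff_false]
      exact fun h => hP (h.1 ▸ h.2.1)
    have e2 := e1 fun _ => True
    simp only [and_true] at e2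
    simp only [Set.mem_ofPred_eq]
    rw [e1 Q, e2, unnormalised_eq_expect]
    simp [expect]

/-- Given that the vertices in large components form the nonempty set `U`, there is exactly one large
component, up to an exponentially small probability. -/
theorem exists_forall_largeVertices_bound {q lam ε : ℝ} (hq : 0 < q) (hlam : 0 < lam)
    (hε : 0 < ε) :
    ∃ c : ℝ, 0 < c ∧ ∀ {V : Type*} [Fintype V], lam ≤ (Fintype.card V : ℝ) →
      ∀ U : Finset V, U.Nonempty →
      (1 - Real.exp (-c * Fintype.card V)) *
        unnormalised ⊤ (lam / Fintype.card V) q {ω : Config (⊤ : SimpleGraph V) |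
          largeVertices (ε * Fintype.card V) ω = U} ≤
      unnormalised ⊤ (lam / Fintype.card V) q {ω : Config (⊤ : SimpleGraph V) |
          largeVertices (ε * Fintype.card V) ω = U ∧ numLarge (ε * Fintype.card V) ω = 1} := by
  obtain ⟨c, hc, h⟩ := exists_mergedWeight_bound hq hlam hε
  refine ⟨c, hc, ?_⟩
  intro V _ hn U hU
  have hn0 : (0 : ℝ) < Fintype.card V := hlam.trans_le hn
  have hp0 : 0 ≤ lam / Fintype.card V := by positivity
  have hp1 : lam / Fintype.card V ≤ 1 := (div_le_one hn0).2 hn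
  rw [unnormalised_largeVertices_eq]
  rcases lt_or_ge (ε * Fintype.card V) (U.card : ℝ) with hlt | hge
  · exact (h hn U hU hlt).trans (mergedWeight_le_unnormalised hp0 hp1 hq.le hU hlt)
  · rw [clusterSum_splitWeight_eq_zero _ _ (by simpa using hU) (by simpa using hge), mul_zero]
    exact unnormalised_nonneg hp0 hp1 hq.le _

end

end RandomCluster


theorem mainTheorem4 (q lam ε : ℝ) (hq : 0 < q) (hlam : 0 < lam) (hε : 0 < ε) :
    ∃ c : ℝ, 0 < c ∧ ∀ n : ℕ, lam ≤ (n : ℝ) →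
      (∀ θ : ℝ, ε < θ →
        (1 - Real.exp (-c * n)) *
            RandomCluster.phi n lam q
              {ω | (RandomCluster.largeVertices (ε * n) ω).ncard = ⌊θ * n⌋₊}
          ≤ RandomCluster.phi n lam q
              {ω | (RandomCluster.largeVertices (ε * n) ω).ncard = ⌊θ * n⌋₊ ∧
                RandomCluster.numLarge (ε * n) ω = 1}) ∧
      1 - Real.exp (-c * n) ≤
        RandomCluster.phi n lam q {ω | RandomCluster.numLarge (ε * n) ω ≤ 1} := by
  obtain ⟨c, hc, h⟩ := RandomCluster.exists_forall_largeVertices_bound hq hlam hε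
  refine ⟨c, hc, fun n hn => ?_⟩
  have hn0 : (0 : ℝ) < n := hlam.trans_le hn
  have hp0 : 0 < lam / n := by positivity
  have hp1 : lam / n ≤ 1 := (div_le_one hn0).2 hn
  have hZ := RandomCluster.partitionFunction_pos (V := Fin n) hp0 hp1 hq
  have hU := h (V := Fin n) (by simpa using hn)
  rw [Fintype.card_fin] at hU
  have hfac : 1 - Real.exp (-c * n) ≤ 1 := by linarith [Real.exp_pos (-c * n)]
  constructor
  · intro θ hθ
    unfold RandomCluster.phi RandomCluster.prob
    rw [← mul_div_assoc]
    refine div_le_div_of_nonneg_right ?_ hZ.le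
    refine RandomCluster.mul_unnormalised_le (fun W => W.ncard = ⌊θ * n⌋₊) _ fun U hUm => ?_
    rcases U.eq_empty_or_nonempty with rfl | hne
    · -- `⌊θ * n⌋ = 0` forces `ε * n < 1`, and then every vertex is in a large component.
      have hfl : ⌊θ * n⌋₊ = 0 := by simpa using hUm.symm
      have hθn : θ * n < 1 := Nat.floor_eq_zero.1 hfl
      have hεn : ε * n < 1 := (mul_lt_mul_of_pos_right hθ hn0).trans hθn
      have hempty : {ω : RandomCluster.Config (RandomCluster.K n) |
          RandomCluster.largeVertices (ε * n) ω = ((∅ : Finset (Fin n)) : Set (Fin n))} = ∅ := by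
        refine Set.eq_empty_iff_forall_notMem.2 fun ω hω => ?_
        have hv : (⟨0, by exact_mod_cast hn0⟩ : Fin n) ∈
            RandomCluster.largeVertices (ε * n) ω := by
          rw [RandomCluster.mem_largeVertices]
          refine hεn.trans_le ?_
          exact_mod_cast Finset.card_pos.2
            ⟨_, RandomCluster.self_mem_cluster _ (Finset.mem_univ _)⟩
        have hω' : RandomCluster.largeVertices (ε * n) ω =
          ((∅ : Finset (Fin n)) : Set (Fin n)) := hω
        rw [hω'] at hv
        simp at hv
      rw [hempty]
      have e : RandomCluster.unnormalised (RandomCluster.K n) (lam / n) q ∅ = 0 := by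
        simp [RandomCluster.unnormalised]
      rw [e, mul_zero]
      exact RandomCluster.unnormalised_nonneg hp0.le hp1 hq.le _
    · exact hU U hne
  · unfold RandomCluster.phi RandomCluster.prob
    rw [le_div_iff₀ hZ]
    have := RandomCluster.mul_unnormalised_le (V := Fin n) (p := lam / n) (q := q) (r := ε * n)
      (s := 1 - Real.exp (-c * n)) (fun _ => True)
      (fun ω => RandomCluster.numLarge (ε * n) ω ≤ 1) fun U _ => by
        rcases U.eq_empty_or_nonempty with rfl | hne
        · refine (mul_le_of_le_one_left
            (RandomCluster.unnormalised_nonneg hp0.le hp1 hq.le _) hfac).trans ?_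
          refine RandomCluster.unnormalised_mono hp0.le hp1 hq.le fun ω hω => ⟨hω, ?_⟩
          rw [RandomCluster.numLarge_eq_zero (by simpa using hω)]
          exact zero_le_one
        · exact (hU U hne).trans (RandomCluster.unnormalised_mono hp0.le hp1 hq.le
            fun ω hω => ⟨hω.1, hω.2.le⟩)
    simpa [RandomCluster.partitionFunction] using this
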